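/- Identify $\mathbb{R}^3$ with the set of quaternions $x_0+x_1e_1+x_2e_2$ (those with vanishing $e_3$ component), with conjugation $\overline{x}=x_0-x_1e_1-x_2e_2$. Put $\partial_j=\partial/\partial x_j$, $D=\partial_0-e_1\partial_1-e_2\partial_2$ and $\overline{D}=\partial_0+e_1\partial_1+e_2\partial_2$, acting from the left by quaternion multiplication. For an open set $\Omega\subseteq\mathbb{R}^3$ let $\mathcal{M}(\Omega)=\{f\in C^1(\Omega,\mathbb{R}^3):\overline{D}f=0\}$ be the space of monogenic functions and $\overline{\mathcal{M}}(\Omega)=\{\overline{f}:f\in\mathcal{M}(\Omega)\}$; the elements of $\mathcal{M}(\Omega)+\overline{\mathcal{M}}(\Omega)$ are called ambigenic. Let $\mathbb{B}^3$ be the open unit ball of $\mathbb{R}^3$, and consider on $L_2(\mathbb{B}^3,\mathbb{R}^3)$ the real scalar product $\langle f,g\rangle=\mathrm{Sc}\int_{\mathbb{B}^3}\overline{f}\,g\,dV=\int_{\mathbb{B}^3}(f_0g_0+f_1g_1+f_2g_2)\,dV$. In spherical coordinates $x_0=r\cos\theta$, $x_1=r\sin\theta\cos\varphi$, $x_2=r\sin\theta\sin\varphi$,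 let $$\widehat U^n_m=r^nP_n^m(\cos\theta)\cos(m\varphi),\qquad \widehat V^n_m=r^nP_n^m(\cos\theta)\sin(m\varphi),$$ where $P_n$ is the Legendre polynomial of degree $n$ and $P_n^m(t)=(1-t^2)^{m/2}\frac{d^m}{dt^m}P_n(t)$. Set $$X^n_m=D[\widehat U^{n+1}_m]\ (0\le m\le n+1),\qquad Y^n_m=D[\widehat V^{n+1}_m]\ (1\le m\le n+1),$$ $$a^n_m=\frac{n-2m^2+1}{(n+1)(2n+1)}\ (0\le m\le n),\qquad a^n_{n+1}=0.$$ Proposition. Let $n>0$. The $4n+4$ functions $$X^{n,+}_m=X^n_m\ (0\le m\le n+1),\qquad Y^{n,+}_m=Y^n_m\ (1\le m\le n),$$ $$X^{n,-}_m=\overline{X^n_m}-a^n_mX^n_m\ (0\le m\le n),\qquad Y^{n,-}_m=\overline{Y^n_m}-a^n_mY^n_m\ (1\le m\le n+1)$$ form an orthogonal basis, with respect to $\langle\cdot,\cdot\rangle$, of the real vector space of square integrable ambigenic functions on $\mathbb{B}^3$ that are homogeneous of degree $n$ (that is, $f(tx)=t^nf(x)$ whenever $t>0$ and $x,tx\in\mathbb{B}^3$).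 -/

import Mathlib

open scoped Quaternion

noncomputable section

namespace Ambigenic

/-- Euclidean space `ℝ³`, with coordinates `x 0, x 1, x 2`. -/
abbrev R3 : Type := EuclideanSpace ℝ (Fin 3)

/-- The quaternion unit `e₁`. Here `ℝ³` as a space of values is the set of quaternions
`x₀ + x₁e₁ + x₂e₂`, that is, those with vanishing `e₃` component `imK`. -/
def e₁ : ℍ[ℝ] := ⟨0, 1, 0, 0⟩

/-- The quaternion unit `e₂`. -/
def e₂ : ℍ[ℝ] := ⟨0, 0, 1, 0⟩

/-- The partial derivative `∂_j F` at `x`. -/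
def partialD (j : Fin 3) (F : R3 → ℍ[ℝ]) (x : R3) : ℍ[ℝ] :=
  fderiv ℝ F x (EuclideanSpace.single j 1)

/-- `D = ∂₀ - e₁∂₁ - e₂∂₂`, acting from the left. -/
def D (F : R3 → ℍ[ℝ]) (x : R3) : ℍ[ℝ] :=
  partialD 0 F x - (e₁ * partialD 1 F x + e₂ * partialD 2 F x)

/-- `D̄ = ∂₀ + e₁∂₁ + e₂∂₂`, acting from the left. -/
def Dbar (F : R3 → ℍ[ℝ]) (x : R3) : ℍ[ℝ] :=
  partialD 0 F x + (e₁ * partialD 1 F x + e₂ * partialD 2 F x)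

/-- The space `𝓜(Ω)` of monogenic functions on the open set `Ω`: the functions `f : Ω → ℝ³` of
class `C¹` with `D̄ f = 0`. A function on `Ω` is differentiated through an extension `F` to `ℝ³`,
whose values outside the open set `Ω` play no role. -/
def monogenic (Ω : TopologicalSpace.Opens R3) : Submodule ℝ (Ω → ℍ[ℝ]) where
  carrier := {f | ∃ F : R3 → ℍ[ℝ], ContDiffOn ℝ 1 F Ω ∧ (∀ x ∈ Ω, (F x).imK = 0) ∧
    (∀ x ∈ Ω, Dbar F x = 0) ∧ ∀ x : Ω, f x = F x}
  zero_mem' := ⟨0, contDiffOn_const, fun _ _ => rfl,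
    fun x _ => by simp [Dbar, partialD], fun _ => rfl⟩
  add_mem' := by
    rintro f g ⟨F, hF, hF3, hF0, hfF⟩ ⟨G, hG, hG3, hG0, hgG⟩
    refine ⟨F + G, hF.add hG, fun x hx => by simp [hF3 x hx, hG3 x hx], fun x hx => ?_,
      fun x => by simp [hfF, hgG]⟩
    have hFx : DifferentiableAt ℝ F x :=
      (hF.differentiableOn one_ne_zero).differentiableAt (Ω.isOpen.mem_nhds hx)
    have hGx : DifferentiableAt ℝ G x :=
      (hG.differentiableOn one_ne_zero).differentiableAt (Ω.isOpen.mem_nhds hx)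
    have h : Dbar (F + G) x = Dbar F x + Dbar G x := by
      simp only [Dbar, partialD, fderiv_add hFx hGx, add_apply, mul_add]
      abel
    rw [h, hF0 x hx, hG0 x hx, add_zero]
  smul_mem' := by
    rintro c f ⟨F, hF, hF3, hF0, hfF⟩
    refine ⟨c • F, hF.const_smul c, fun x hx => by simp [hF3 x hx], fun x hx => ?_,
      fun x => by simp [hfF]⟩
    have hFx : DifferentiableAt ℝ F x :=
      (hF.differentiableOn one_ne_zero).differentiableAt (Ω.isOpen.mem_nhds hx)
    have h : Dbar (c • F) x = c • Dbar F x := by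
      simp only [Dbar, partialD, fderiv_const_smul hFx, smul_apply,
        mul_smul_comm, smul_add]
    rw [h, hF0 x hx, smul_zero]

/-- Pointwise quaternionic conjugation of functions. -/
def conjMap (Ω : TopologicalSpace.Opens R3) : (Ω → ℍ[ℝ]) →ₗ[ℝ] (Ω → ℍ[ℝ]) where
  toFun f := fun x => star (f x)
  map_add' f g := by ext1 x; simp
  map_smul' c f := by ext1 x; simp

/-- The space `𝓜(Ω) + conj 𝓜(Ω)` of ambigenic functions on `Ω`. -/
def ambigenic (Ω : TopologicalSpace.Opens R3) : Submodule ℝ (Ω → ℍ[ℝ]) :=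
  monogenic Ω ⊔ (monogenic Ω).map (conjMap Ω)

/-- The open unit ball `𝔹³`. -/
def unitBall : TopologicalSpace.Opens R3 := ⟨Metric.ball 0 1, Metric.isOpen_ball⟩

/-- Lebesgue measure on `𝔹³`. -/
def ballVolume : MeasureTheory.Measure unitBall :=
  MeasureTheory.Measure.comap Subtype.val (MeasureTheory.volume : MeasureTheory.Measure R3)

/-- `f` is homogeneous of degree `n` on `Ω`: `f (t x) = tⁿ f x` whenever `t > 0` and both
`x` and `t x` lie in `Ω`. -/
def IsHomogeneous {Ω : TopologicalSpace.Opens R3} (n : ℕ) (f : Ω → ℍ[ℝ]) : Prop :=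
  ∀ t : ℝ, 0 < t → ∀ x y : Ω, (y : R3) = t • (x : R3) → f y = t ^ n • f x

/-- The space of square integrable ambigenic functions on `𝔹³` that are homogeneous of
degree `n`. -/
def homogeneousAmbigenic (n : ℕ) : Submodule ℝ (unitBall → ℍ[ℝ]) where
  carrier := {f | f ∈ ambigenic unitBall ∧
    MeasureTheory.MemLp f 2 ballVolume ∧
    IsHomogeneous n f}
  zero_mem' := ⟨Submodule.zero_mem _, MeasureTheory.MemLp.zero, fun t _ x y _ => by simp⟩
  add_mem' := by
    rintro f g ⟨hf, hf2, hfn⟩ ⟨hg, hg2, hgn⟩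
    exact ⟨Submodule.add_mem _ hf hg, hf2.add hg2,
      fun t ht x y h => by simp [hfn t ht x y h, hgn t ht x y h]⟩
  smul_mem' := by
    rintro c f ⟨hf, hf2, hfn⟩
    exact ⟨Submodule.smul_mem _ c hf, hf2.const_smul c,
      fun t ht x y h => by simp only [Pi.smul_apply, hfn t ht x y h]; exact smul_comm _ _ _⟩

/-- The scalar product `⟨f, g⟩ = Sc ∫ conj(f) g dV = ∫ (f₀g₀ + f₁g₁ + f₂g₂) dV` on `𝔹³`. -/
def scalarProduct (f g : unitBall → ℍ[ℝ]) : ℝ :=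
  ∫ x, (star (f x) * g x).re ∂ballVolume

/-- The Legendre polynomial `P_n`, by Rodrigues' formula. -/
def legendreP (n : ℕ) : Polynomial ℝ :=
  Polynomial.C ((1 : ℝ) / (2 ^ n * (n.factorial : ℝ))) *
    Polynomial.derivative^[n] ((Polynomial.X ^ 2 - 1) ^ n)

/-- The associated Legendre function `P_n^m(t) = (1 - t²)^{m/2} (d/dt)^m P_n(t)`, `|t| ≤ 1`. -/
def assocLegendre (n m : ℕ) (t : ℝ) : ℝ :=
  √(1 - t ^ 2) ^ m * (Polynomial.derivative^[m] (legendreP n)).eval t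

/-- The azimuth `φ` of `x`, where `x₀ = r cos θ`, `x₁ = r sin θ cos φ`, `x₂ = r sin θ sin φ`. -/
def azimuth (x : R3) : ℝ := Complex.arg ⟨x 1, x 2⟩

/-- The solid spherical harmonic `Û^n_m = rⁿ P_n^m(cos θ) cos (m φ)`. -/
def solidU (n m : ℕ) (x : R3) : ℝ :=
  ‖x‖ ^ n * assocLegendre n m (x 0 / ‖x‖) * Real.cos (m * azimuth x)

/-- The solid spherical harmonic `V̂^n_m = rⁿ P_n^m(cos θ) sin (m φ)`. -/
def solidV (n m : ℕ) (x : R3) : ℝ :=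
  ‖x‖ ^ n * assocLegendre n m (x 0 / ‖x‖) * Real.sin (m * azimuth x)

/-- `X^n_m = D[Û^{n+1}_m]` on `𝔹³`. -/
def X (n m : ℕ) : unitBall → ℍ[ℝ] := fun x => D (fun y => (solidU (n + 1) m y : ℍ[ℝ])) x

/-- `Y^n_m = D[V̂^{n+1}_m]` on `𝔹³`. -/
def Y (n m : ℕ) : unitBall → ℍ[ℝ] := fun x => D (fun y => (solidV (n + 1) m y : ℍ[ℝ])) x

/-- The coefficients `a^n_m` for `0 ≤ m ≤ n + 1`, with `a^n_{n+1} = 0`. -/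
def a (n m : ℕ) : ℝ :=
  if m = n + 1 then 0 else ((n : ℝ) - 2 * (m : ℝ) ^ 2 + 1) / (((n : ℝ) + 1) * (2 * (n : ℝ) + 1))

/-- `X^{n,+}_m`. -/
def Xplus (n m : ℕ) : unitBall → ℍ[ℝ] := X n m

/-- `Y^{n,+}_m`. -/
def Yplus (n m : ℕ) : unitBall → ℍ[ℝ] := Y n m

/-- `X^{n,-}_m = conj(X^n_m) - a^n_m X^n_m`. -/
def Xminus (n m : ℕ) : unitBall → ℍ[ℝ] := conjMap unitBall (X n m) - a n m • X n m

/-- `Y^{n,-}_m = conj(Y^n_m) - a^n_m Y^n_m`. -/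
def Yminus (n m : ℕ) : unitBall → ℍ[ℝ] := conjMap unitBall (Y n m) - a n m • Y n m

/-- The functions `X^{n,+}_m` (`0 ≤ m ≤ n + 1`), `Y^{n,+}_m` (`1 ≤ m ≤ n`),
`X^{n,-}_m` (`0 ≤ m ≤ n`) and `Y^{n,-}_m` (`1 ≤ m ≤ n + 1`). -/
def family (n : ℕ) : Fin (n + 2) ⊕ Fin n ⊕ Fin (n + 1) ⊕ Fin (n + 1) → unitBall → ℍ[ℝ]
  | Sum.inl m => Xplus n m
  | Sum.inr (Sum.inl m) => Yplus n (m + 1)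
  | Sum.inr (Sum.inr (Sum.inl m)) => Xminus n m
  | Sum.inr (Sum.inr (Sum.inr m)) => Yminus n (m + 1)

end Ambigenic

end

/-! For real u, D u = (∂₀u, -∂₁u, -∂₂u), and conjugation flips the last two signs. Hence every
member of the family is a field (α∂₀u, -β∂₁u, -β∂₂u), where u is a solid harmonic of degree n+1 and
α, β are constants (`family_eq`). The angular definition of u is replaced by a polynomial with the
same three-term recursion (`solidU_eq`, `solidV_eq`).

Orthogonality: the integrands are homogeneous polynomials, so an integral over the ball vanishes
once the integral against exp(-|x|²) does (`integral_ball_eq_zero`). For the Gaussian weight,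
integration by parts turns the problem into algebra. Rotation about the x₀-axis is skew, which
separates different orders m, and cosine from sine. What remains is the pair X, conj X:
`map_gradForm_weight` finds ⟨conj X, X⟩ = a ⟨X, X⟩, so X⁻ is one Gram–Schmidt step. For m = n+1, ∂₀u
= 0 and conj X = -X, which is why each of the two sectorial harmonics enters with one sign only.
Independence follows from orthogonality and positive norms, where n > 0 gives a ≠ 1.

Spanning: f is monogenic exactly when (f₀, -f₁, -f₂) is divergence free and curl free. A C¹ field of
this kind has a mean value property, hence is smooth (`contDiffAt_of_div_curl_free`) and harmonic.
For ambigenic f the three components are therefore harmonic, and the planar part remains curl free.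
Homogeneity extends them to ℝ³, where homogeneous harmonic functions are combinations of the solid
harmonics (`harmonicHom_le_solidSpan`). Then f₀ = ∂₀w and (-f₁, -f₂) = (∂₁v, ∂₂v) with v, w harmonic
of degree n+1 (`exists_planar_potential`), and such fields lie in the span of the family
(`gradField_mem_span`). -/

noncomputable section

namespace SolidHarmonic
open Polynomial
open Ambigenic (legendreP)

/-! ### Legendre polynomials -/

lemma legendreP_zero : legendreP 0 = 1 := by simp [legendreP]

lemma derivative_sq_sub_one_pow (n : ℕ) :
    derivative ((X ^ 2 - 1 : ℝ[X]) ^ (n + 1)) =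
      C (2 * ((n : ℝ) + 1)) * ((X ^ 2 - 1) ^ n * X) := by
  rw [derivative_pow]
  simp only [Nat.add_sub_cancel, derivative_sub, derivative_X_pow, derivative_one, map_mul,
    map_add, map_ofNat, map_natCast, Nat.cast_add, Nat.cast_one, map_one]
  push_cast
  ring

lemma derivative_derivative_sq_sub_one_pow (n : ℕ) :
    derivative (derivative ((X ^ 2 - 1 : ℝ[X]) ^ (n + 2))) =
      C (2 * ((n : ℝ) + 2)) * (C (2 * (n : ℝ) + 3) * (X ^ 2 - 1) ^ (n + 1) +
        C (2 * ((n : ℝ) + 1)) * (X ^ 2 - 1) ^ n) := by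
  rw [derivative_sq_sub_one_pow (n + 1), derivative_C_mul, derivative_mul,
    derivative_sq_sub_one_pow]
  simp only [map_mul, map_add, map_ofNat, map_natCast, Nat.cast_add, Nat.cast_one, map_one,
    derivative_X]
  ring

/-- The normalizing constant in Rodrigues' formula. -/
def rodriguesCoeff (n : ℕ) : ℝ := 1 / (2 ^ n * (n.factorial : ℝ))

lemma rodriguesCoeff_succ (n : ℕ) :
    rodriguesCoeff (n + 1) * (2 * ((n : ℝ) + 1)) = rodriguesCoeff n := by
  have h1 : (n.factorial : ℝ) ≠ 0 := by positivity
  have h2 : (n : ℝ) + 1 ≠ 0 := by positivity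
  simp only [rodriguesCoeff, Nat.factorial_succ, pow_succ]
  push_cast
  field_simp

lemma legendreP_eq (n : ℕ) :
    legendreP n = C (rodriguesCoeff n) * derivative^[n] ((X ^ 2 - 1) ^ n) := rfl

/-- Two of the n+3 derivatives already reduce (X²-1)^(n+2) to a combination of (X²-1)^(n+1) and
(X²-1)^n; the other n+1 produce P_{n+1} and P_n'. -/
lemma derivative_legendreP_add_two (n : ℕ) :
    derivative (legendreP (n + 2)) =
      C (2 * (n : ℝ) + 3) * legendreP (n + 1) + derivative (legendreP n) := by
  have h : derivative (legendreP (n + 2)) = C (rodriguesCoeff (n + 2)) *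
      derivative^[n + 1] (derivative (derivative ((X ^ 2 - 1 : ℝ[X]) ^ (n + 2)))) := by
    rw [legendreP_eq, derivative_C_mul, ← Function.iterate_succ_apply' derivative,
      Function.iterate_succ_apply, Function.iterate_succ_apply]
  rw [h, derivative_derivative_sq_sub_one_pow, iterate_derivative_C_mul, iterate_map_add,
    iterate_derivative_C_mul, iterate_derivative_C_mul, legendreP_eq (n + 1), legendreP_eq n,
    derivative_C_mul, ← Function.iterate_succ_apply' derivative, ← rodriguesCoeff_succ n,
    ← rodriguesCoeff_succ (n + 1)]
  simp only [map_mul, map_add, map_ofNat, map_natCast, Nat.cast_add, Nat.cast_one, map_one]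
  ring

/-- Leibniz for (X²-1)^n · X stops after one extra term since X is linear. At n = 0 the truncated
exponent `n - 1` is harmless: its coefficient is 0. -/
lemma legendreP_succ_eq (n : ℕ) :
    legendreP (n + 1) = X * legendreP n +
      C (n * rodriguesCoeff n) * derivative^[n - 1] ((X ^ 2 - 1) ^ n) := by
  have h : legendreP (n + 1) =
      C (rodriguesCoeff (n + 1)) * derivative^[n] (derivative ((X ^ 2 - 1 : ℝ[X]) ^ (n + 1))) := by
    rw [legendreP_eq, Function.iterate_succ_apply]
  rw [h, derivative_sq_sub_one_pow, iterate_derivative_C_mul, iterate_derivative_mul_X,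
    legendreP_eq n, ← rodriguesCoeff_succ n]
  simp only [map_mul, map_add, map_ofNat, map_natCast, map_one, nsmul_eq_mul]
  ring

lemma derivative_legendreP_succ (n : ℕ) :
    derivative (legendreP (n + 1)) =
      C ((n : ℝ) + 1) * legendreP n + X * derivative (legendreP n) := by
  rw [legendreP_succ_eq, derivative_add, derivative_mul, derivative_X, derivative_C_mul]
  rcases n with _ | n
  · simp
  · rw [Nat.add_sub_cancel, ← Function.iterate_succ_apply' derivative, legendreP_eq (n + 1)]
    simp only [map_mul, map_add, map_natCast, map_one]
    ring

lemma eval_one_legendreP (n : ℕ) : (legendreP n).eval 1 = 1 := by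
  induction n with
  | zero => simp [legendreP_zero]
  | succ n ih =>
    rw [legendreP_succ_eq]
    simp only [eval_add, eval_mul, eval_X, eval_C, ih]
    rcases n with _ | n
    · simp
    · have h := pow_sub_dvd_iterate_derivative_pow (X ^ 2 - 1 : ℝ[X]) (n + 1) n
      rw [Nat.add_sub_cancel_left, pow_one] at h
      obtain ⟨q, hq⟩ := h
      rw [Nat.add_sub_cancel, hq]
      simp

/-- Bonnet's recursion. -/
lemma legendreP_add_two (n : ℕ) :
    C ((n : ℝ) + 2) * legendreP (n + 2) =
      C (2 * (n : ℝ) + 3) * (X * legendreP (n + 1)) - C ((n : ℝ) + 1) * legendreP n := by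
  rw [← sub_eq_zero]
  -- The defect q has zero derivative by the two derivative recursions, and vanishes at 1, where
  -- every P_n equals 1.
  set q := C ((n : ℝ) + 2) * legendreP (n + 2) -
    (C (2 * (n : ℝ) + 3) * (X * legendreP (n + 1)) - C ((n : ℝ) + 1) * legendreP n) with hq
  have h0 : derivative q = 0 := by
    have e1 := derivative_legendreP_add_two n
    have e2 := derivative_legendreP_succ (n + 1)
    simp only [hq, derivative_sub, derivative_mul, derivative_C, derivative_X]
    simp only [map_mul, map_add, map_ofNat, map_natCast, map_one, Nat.cast_add, Nat.cast_one]
      at e1 e2 ⊢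
    linear_combination (-(n : ℝ[X]) - 1) * e1 + (2 * (n : ℝ[X]) + 3) * e2
  have h1 := eq_C_of_derivative_eq_zero h0
  have h2 : q.eval 1 = 0 := by
    simp only [hq, eval_sub, eval_mul, eval_C, eval_X, eval_one_legendreP]
    ring
  rw [h1, eval_C] at h2
  rw [h1, h2, C_0]

/-- Differentiating Bonnet's recursion m times leaves a stray (m-1)-st derivative of P_{n+1}, which
`derivative_legendreP_add_two` eliminates. With n = m + k these are the coefficients in `solid`. -/
lemma iterate_derivative_legendreP_add_two (n m : ℕ) :
    C ((n : ℝ) + 2 - m) * derivative^[m] (legendreP (n + 2)) =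
      C (2 * (n : ℝ) + 3) * (X * derivative^[m] (legendreP (n + 1))) -
        C ((n : ℝ) + 1 + m) * derivative^[m] (legendreP n) := by
  have h := congrArg (derivative^[m]) (legendreP_add_two n)
  rw [iterate_derivative_sub, iterate_derivative_C_mul, iterate_derivative_C_mul,
    iterate_derivative_C_mul, mul_comm X, iterate_derivative_mul_X] at h
  rcases m with _ | m
  · simpa [mul_comm X] using h
  · have e := congrArg (derivative^[m]) (derivative_legendreP_add_two n)
    rw [iterate_map_add, iterate_derivative_C_mul, ← Function.iterate_succ_apply,
      ← Function.iterate_succ_apply] at e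
    simp only [map_mul, map_add, map_sub, map_ofNat, map_natCast, map_one, Nat.cast_add,
      Nat.cast_one, nsmul_eq_mul, Nat.add_sub_cancel, Nat.succ_eq_add_one] at h e ⊢
    linear_combination h - ((m : ℝ[X]) + 1) * e

lemma iterate_derivative_legendreP_of_lt {n m : ℕ} (h : n < m) :
    derivative^[m] (legendreP n) = 0 := by
  apply iterate_derivative_eq_zero
  refine lt_of_le_of_lt ?_ h
  rw [legendreP_eq]
  refine (natDegree_C_mul_le _ _).trans ?_
  refine (natDegree_iterate_derivative _ _).trans ?_
  have : natDegree ((X ^ 2 - 1 : ℝ[X]) ^ n) ≤ n * 2 := by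
    refine natDegree_pow_le_of_le _ ?_
    compute_degree
  omega

/-- The value `(2m-1)!!` of the constant polynomial `P_m^{(m)}`. -/
def sectorialCoeff : ℕ → ℝ
  | 0 => 1
  | m + 1 => (2 * m + 1) * sectorialCoeff m

lemma sectorialCoeff_ne_zero (m : ℕ) : sectorialCoeff m ≠ 0 := by
  induction m with
  | zero => simp [sectorialCoeff]
  | succ m ih =>
    rw [sectorialCoeff]
    exact mul_ne_zero (by positivity) ih

lemma iterate_derivative_legendreP_self (m : ℕ) :
    derivative^[m] (legendreP m) = C (sectorialCoeff m) := by
  induction m with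
  | zero => simp [legendreP_zero, sectorialCoeff]
  | succ m ih =>
    rw [Function.iterate_succ_apply, derivative_legendreP_succ, iterate_map_add,
      iterate_derivative_C_mul, mul_comm X, iterate_derivative_mul_X,
      ← Function.iterate_succ_apply, iterate_derivative_legendreP_of_lt (Nat.lt_succ_self m)]
    rcases m with _ | m
    · simp [legendreP_zero, sectorialCoeff]
    · rw [Nat.add_sub_cancel, ← Function.iterate_succ_apply, ih,
        show sectorialCoeff (m + 1 + 1) = (2 * (m + 1 : ℕ) + 1) * sectorialCoeff (m + 1) from rfl]
      simp only [map_mul, map_add, map_ofNat, map_natCast, map_one, Nat.cast_add, Nat.cast_one,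
        nsmul_eq_mul]
      ring

lemma iterate_derivative_legendreP_succ_self (m : ℕ) :
    derivative^[m] (legendreP (m + 1)) = C ((2 * (m : ℝ) + 1) * sectorialCoeff m) * X := by
  rcases m with _ | m
  · simp [legendreP_succ_eq 0, legendreP_zero, sectorialCoeff]
  · have h := iterate_derivative_legendreP_add_two m (m + 1)
    rw [iterate_derivative_legendreP_self, iterate_derivative_legendreP_of_lt (Nat.lt_succ_self m)]
      at h
    simp only [map_mul, map_add, map_sub, map_ofNat, map_natCast, map_one, Nat.cast_add,
        Nat.cast_one] at h ⊢
    linear_combination h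

end SolidHarmonic

namespace SolidHarmonic
open MvPolynomial

/-! ### Solid spherical harmonics as polynomials -/

/-- Real polynomials in the three coordinates. -/
abbrev Poly : Type := MvPolynomial (Fin 3) ℝ

/-- The Laplacian of a polynomial. -/
def lap (p : Poly) : Poly :=
  pderiv 0 (pderiv 0 p) + pderiv 1 (pderiv 1 p) + pderiv 2 (pderiv 2 p)

/-- The infinitesimal rotation about the `x₀`-axis. -/
def rot (p : Poly) : Poly := X 1 * pderiv 2 p - X 2 * pderiv 1 p

/-- The polynomial `|x|²`. -/
def normSq : Poly := X 0 ^ 2 + X 1 ^ 2 + X 2 ^ 2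

/-- Real and imaginary part of `(x₁ + i x₂)^m`. -/
def cosSin : ℕ → Poly × Poly
  | 0 => (1, 0)
  | m + 1 => (X 1 * (cosSin m).1 - X 2 * (cosSin m).2, X 1 * (cosSin m).2 + X 2 * (cosSin m).1)

/-- The solid harmonic of degree `m + k` which arises from the sectorial harmonic `h` of
degree `m` through the three-term recursion of the associated Legendre functions. -/
def solid (m : ℕ) (h : Poly) : ℕ → Poly
  | 0 => h
  | 1 => C (2 * (m : ℝ) + 1) * (X 0 * h)
  | k + 2 => C (1 / ((k : ℝ) + 2)) * (C (2 * (m + k + 1 : ℝ) + 1) * (X 0 * solid m h (k + 1)) -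
      C (k + 1 + 2 * m : ℝ) * (normSq * solid m h k))

lemma C_mul_cancel {c : ℝ} (hc : c ≠ 0) {p q : Poly} (h : C c * p = C c * q) : p = q := by
  have h1 : (C (1 / c) : Poly) * C c = 1 := by rw [← C_mul, one_div_mul_cancel hc, C_1]
  rw [← one_mul p, ← one_mul q, ← h1, mul_assoc, mul_assoc, h]

lemma solid_add_two (m : ℕ) (h : Poly) (k : ℕ) :
    C ((k : ℝ) + 2) * solid m h (k + 2) =
      C (2 * (m + k + 1 : ℝ) + 1) * (X 0 * solid m h (k + 1)) -
      C (k + 1 + 2 * m : ℝ) * (normSq * solid m h k) := by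
  have hk : (k : ℝ) + 2 ≠ 0 := by positivity
  rw [solid, ← mul_assoc, ← C_mul, mul_one_div_cancel hk, C_1, one_mul]

/-- The commutator of two derivations is a derivation, and this one kills the variables. -/
lemma pderiv_comm (i j : Fin 3) (p : Poly) : pderiv i (pderiv j p) = pderiv j (pderiv i p) := by
  have h : ⁅(pderiv i : Derivation ℝ Poly Poly), (pderiv j : Derivation ℝ Poly Poly)⁆ = 0 := by
    apply MvPolynomial.derivation_ext
    intro k
    simp only [Derivation.commutator_apply, pderiv_X, Derivation.zero_apply, Pi.single_apply]
    split_ifs <;> simp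
  have := congrArg (fun d : Derivation ℝ Poly Poly => d p) h
  simpa [Derivation.commutator_apply, sub_eq_zero] using this

lemma pderiv_zero_X : pderiv 0 (X 0 : Poly) = 1 ∧ pderiv 0 (X 1 : Poly) = 0 ∧
    pderiv 0 (X 2 : Poly) = 0 :=
  ⟨pderiv_X_self 0, pderiv_X_of_ne (by decide), pderiv_X_of_ne (by decide)⟩

lemma pderiv_one_X : pderiv 1 (X 0 : Poly) = 0 ∧ pderiv 1 (X 1 : Poly) = 1 ∧
    pderiv 1 (X 2 : Poly) = 0 :=
  ⟨pderiv_X_of_ne (by decide), pderiv_X_self 1, pderiv_X_of_ne (by decide)⟩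

lemma pderiv_two_X : pderiv 2 (X 0 : Poly) = 0 ∧ pderiv 2 (X 1 : Poly) = 0 ∧
    pderiv 2 (X 2 : Poly) = 1 :=
  ⟨pderiv_X_of_ne (by decide), pderiv_X_of_ne (by decide), pderiv_X_self 2⟩

lemma pderiv_normSq (i : Fin 3) : pderiv i normSq = 2 * X i := by
  fin_cases i <;> simp [normSq]

lemma euler {d : ℕ} {p : Poly} (hp : p.IsHomogeneous d) :
    X 0 * pderiv 0 p + X 1 * pderiv 1 p + X 2 * pderiv 2 p = C (d : ℝ) * p := by
  have := hp.sum_X_mul_pderiv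
  simpa [Fin.sum_univ_three] using this

lemma isHomogeneous_C_mul {d : ℕ} {p : Poly} (c : ℝ) (hp : p.IsHomogeneous d) :
    (C c * p).IsHomogeneous d := by
  simpa using (isHomogeneous_C (Fin 3) c).mul hp

lemma isHomogeneous_X_mul {d : ℕ} {p : Poly} (i : Fin 3) (hp : p.IsHomogeneous d) :
    (X i * p).IsHomogeneous (d + 1) := by
  simpa [add_comm] using (isHomogeneous_X ℝ i).mul hp

lemma isHomogeneous_normSq : normSq.IsHomogeneous 2 :=
  ((isHomogeneous_X_pow 0 2).add (isHomogeneous_X_pow 1 2)).add (isHomogeneous_X_pow 2 2)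

/-! #### Sectorial harmonics -/

lemma isHomogeneous_cosSin (m : ℕ) :
    (cosSin m).1.IsHomogeneous m ∧ (cosSin m).2.IsHomogeneous m := by
  induction m with
  | zero => exact ⟨isHomogeneous_one _ _, isHomogeneous_zero _ _ _⟩
  | succ m ih =>
    exact ⟨(isHomogeneous_X_mul 1 ih.1).sub (isHomogeneous_X_mul 2 ih.2),
      (isHomogeneous_X_mul 1 ih.2).add (isHomogeneous_X_mul 2 ih.1)⟩

lemma pderiv_zero_cosSin (m : ℕ) :
    pderiv 0 (cosSin m).1 = 0 ∧ pderiv 0 (cosSin m).2 = 0 := by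
  induction m with
  | zero => simp [cosSin]
  | succ m ih => simp [cosSin, ih]

lemma pderiv_cosSin_succ (m : ℕ) :
    (pderiv 1 (cosSin (m + 1)).1 = C ((m : ℝ) + 1) * (cosSin m).1 ∧
      pderiv 1 (cosSin (m + 1)).2 = C ((m : ℝ) + 1) * (cosSin m).2) ∧
    (pderiv 2 (cosSin (m + 1)).1 = -(C ((m : ℝ) + 1) * (cosSin m).2) ∧
      pderiv 2 (cosSin (m + 1)).2 = C ((m : ℝ) + 1) * (cosSin m).1) := by
  induction m with
  | zero => simp [cosSin]
  | succ m ih =>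
    obtain ⟨⟨h1, h2⟩, h3, h4⟩ := ih
    rw [cosSin]
    simp only [map_add, map_sub, pderiv_mul, pderiv_one_X, pderiv_two_X, h1, h2, h3, h4]
    rw [cosSin]
    simp only [map_add, map_natCast, map_one, Nat.cast_add, Nat.cast_one]
    refine ⟨⟨?_, ?_⟩, ?_, ?_⟩ <;> ring

lemma lap_cosSin (m : ℕ) : lap (cosSin m).1 = 0 ∧ lap (cosSin m).2 = 0 := by
  rcases m with _ | _ | m
  · simp [lap, cosSin]
  · simp [lap, cosSin]
  · obtain ⟨⟨h1, h2⟩, h3, h4⟩ := pderiv_cosSin_succ (m + 1)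
    obtain ⟨⟨h5, h6⟩, h7, h8⟩ := pderiv_cosSin_succ m
    obtain ⟨h9, h10⟩ := pderiv_zero_cosSin (m + 1 + 1)
    simp [lap, h1, h2, h3, h4, h5, h6, h7, h8, h9, h10, -map_add, -map_natCast,
      -C_add]

lemma rot_cosSin (m : ℕ) :
    rot (cosSin m).1 = C (-(m : ℝ)) * (cosSin m).2 ∧
      rot (cosSin m).2 = C (m : ℝ) * (cosSin m).1 := by
  rcases m with _ | m
  · simp [rot, cosSin]
  · obtain ⟨⟨h1, h2⟩, h3, h4⟩ := pderiv_cosSin_succ m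
    simp only [rot, h1, h2, h3, h4]
    rw [cosSin]
    simp only [map_neg, map_natCast, Nat.cast_add, Nat.cast_one, map_add, map_one]
    constructor <;> ring

/-! #### Zonal factors -/

lemma isHomogeneous_solid {m : ℕ} {h : Poly} (hh : h.IsHomogeneous m) :
    ∀ k, (solid m h k).IsHomogeneous (m + k) := by
  have key : ∀ k, (solid m h k).IsHomogeneous (m + k) ∧
      (solid m h (k + 1)).IsHomogeneous (m + (k + 1)) := by
    intro k
    induction k with
    | zero => exact ⟨hh, isHomogeneous_C_mul _ (isHomogeneous_X_mul 0 hh)⟩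
    | succ k ih =>
      refine ⟨ih.2, isHomogeneous_C_mul _ ((isHomogeneous_C_mul _ ?_).sub
        (isHomogeneous_C_mul _ ?_))⟩
      · exact isHomogeneous_X_mul 0 ih.2
      · have := isHomogeneous_normSq.mul ih.1
        rwa [show 2 + (m + k) = m + (k + 1 + 1) by ring] at this
  exact fun k => (key k).1

/-- This lowering relation yields harmonicity of `solid` and later makes ∂₀ surjective between
consecutive degrees. The induction carries two consecutive indices because the recursion has depth
two. -/
lemma pderiv_zero_solid {m : ℕ} {h : Poly} (h0 : pderiv 0 h = 0) :
    ∀ k : ℕ, pderiv 0 (solid m h (k + 1)) = C (k + 1 + 2 * m : ℝ) * solid m h k := by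
  have e1 : pderiv 0 (solid m h 1) = C (2 * (m : ℝ) + 1) * h := by
    simp [solid, h0]
  have step : ∀ k : ℕ, C (k + 2 : ℝ) * pderiv 0 (solid m h (k + 2)) =
      C (2 * (m + k + 1 : ℝ) + 1) * (solid m h (k + 1) + X 0 * pderiv 0 (solid m h (k + 1))) -
      C (k + 1 + 2 * m : ℝ) * (2 * X 0 * solid m h k + normSq * pderiv 0 (solid m h k)) := by
    intro k
    have := congrArg (pderiv 0) (solid_add_two m h k)
    simpa only [map_sub, pderiv_C, pderiv_mul, pderiv_zero_X, pderiv_normSq, one_mul, zero_mul,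
      zero_add]
      using this
  have key : ∀ k : ℕ, pderiv 0 (solid m h (k + 1)) = C (k + 1 + 2 * m : ℝ) * solid m h k ∧
      pderiv 0 (solid m h (k + 2)) = C (k + 2 + 2 * m : ℝ) * solid m h (k + 1) := by
    intro k
    induction k with
    | zero =>
      constructor
      · rw [e1]
        simp only [solid]
        simp only [map_add, map_mul, map_ofNat, map_natCast, map_one, Nat.cast_zero, map_zero]
        ring
      · apply C_mul_cancel (c := (2 : ℝ)) two_ne_zero
        have := step 0
        rw [e1] at this
        simp only [solid, h0, zero_add, map_add, map_mul, map_ofNat, map_natCast, map_one,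
          Nat.cast_zero, map_zero] at this ⊢
        linear_combination this
    | succ k ih =>
      obtain ⟨i1, i2⟩ := ih
      refine ⟨?_, ?_⟩
      · rw [i2]
        simp only [map_add, map_mul, map_ofNat, map_natCast, map_one, Nat.cast_add, Nat.cast_one]
        ring
      · apply C_mul_cancel (c := (k : ℝ) + 3) (by positivity)
        have s1 := step (k + 1)
        have s2 := solid_add_two m h k
        rw [i1, i2] at s1
        simp only [map_add, map_mul, map_ofNat, map_natCast, map_one, Nat.cast_add, Nat.cast_one]
          at s1 s2 ⊢
        linear_combination s1 - ((k : Poly) + 2 + 2 * m) * s2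
  exact fun k => (key k).1

lemma lap_C_mul (c : ℝ) (p : Poly) : lap (C c * p) = C c * lap p := by
  simp only [lap, pderiv_C_mul]
  ring

lemma lap_sub (p q : Poly) : lap (p - q) = lap p - lap q := by
  simp only [lap, map_sub]
  ring

lemma lap_X_mul (p : Poly) : lap (X 0 * p) = X 0 * lap p + 2 * pderiv 0 p := by
  simp only [lap, pderiv_mul, pderiv_zero_X, pderiv_one_X, pderiv_two_X, map_add, pderiv_one,
    map_zero]
  ring

lemma lap_normSq_mul {d : ℕ} {p : Poly} (hp : p.IsHomogeneous d) :
    lap (normSq * p) = normSq * lap p + C (4 * (d : ℝ) + 6) * p := by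
  have he := euler hp
  have h2 : ∀ i : Fin 3, pderiv i (2 : Poly) = 0 := fun i => by
    have := pderiv_C (i := i) (a := (2 : ℝ))
    rwa [map_ofNat] at this
  simp only [lap, pderiv_mul, pderiv_zero_X, pderiv_one_X, pderiv_two_X, map_add,
    pderiv_normSq, h2]
  simp only [map_mul, map_ofNat, map_natCast] at he ⊢
  linear_combination 4 * he

/-- In the recursion, x₀· contributes 2∂₀ of the previous term and |x|²· contributes 4(m+k)+6 times
the one before; the lowering relation makes them cancel. -/
lemma lap_solid {m : ℕ} {h : Poly} (hh : h.IsHomogeneous m) (h0 : pderiv 0 h = 0)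
    (hl : lap h = 0) : ∀ k, lap (solid m h k) = 0 := by
  have key : ∀ k, lap (solid m h k) = 0 ∧ lap (solid m h (k + 1)) = 0 := by
    intro k
    induction k with
    | zero =>
      refine ⟨hl, ?_⟩
      rw [zero_add, solid, lap_C_mul, lap_X_mul, hl, h0]
      simp
    | succ k ih =>
      refine ⟨ih.2, ?_⟩
      apply C_mul_cancel (c := (k : ℝ) + 2) (by positivity)
      rw [← lap_C_mul, solid_add_two, lap_sub, lap_C_mul, lap_C_mul, lap_X_mul,
        lap_normSq_mul (isHomogeneous_solid hh k), ih.1, ih.2, pderiv_zero_solid h0]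
      simp only [map_add, map_mul, map_ofNat, map_natCast, map_one, Nat.cast_add]
      ring
  exact fun k => (key k).1

lemma rot_sub (p q : Poly) : rot (p - q) = rot p - rot q := by
  simp only [rot, map_sub]; ring

lemma rot_mul (p q : Poly) : rot (p * q) = rot p * q + p * rot q := by
  simp only [rot, pderiv_mul]; ring

lemma rot_C_mul (c : ℝ) (p : Poly) : rot (C c * p) = C c * rot p := by
  simp only [rot, pderiv_C_mul]; ring

lemma rot_X_zero : rot (X 0) = 0 := by
  simp [rot]

lemma rot_normSq : rot normSq = 0 := by
  simp only [rot, pderiv_normSq]; ring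

/-- The rotation kills x₀ and |x|², the only multipliers in the recursion. -/
lemma rot_solid (m : ℕ) (h : Poly) : ∀ k, rot (solid m h k) = solid m (rot h) k := by
  have key : ∀ k, rot (solid m h k) = solid m (rot h) k ∧
      rot (solid m h (k + 1)) = solid m (rot h) (k + 1) := by
    intro k
    induction k with
    | zero => exact ⟨rfl, by rw [zero_add, solid, solid, rot_C_mul, rot_mul, rot_X_zero]; ring⟩
    | succ k ih =>
      refine ⟨ih.2, ?_⟩
      rw [solid, solid, rot_C_mul, rot_sub, rot_C_mul, rot_C_mul, rot_mul, rot_mul, rot_X_zero,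
        rot_normSq, ih.1, ih.2]
      ring
  exact fun k => (key k).1

lemma solid_C_mul (m : ℕ) (c : ℝ) (h : Poly) : ∀ k, solid m (C c * h) k = C c * solid m h k := by
  have key : ∀ k, solid m (C c * h) k = C c * solid m h k ∧
      solid m (C c * h) (k + 1) = C c * solid m h (k + 1) := by
    intro k
    induction k with
    | zero => exact ⟨rfl, by rw [zero_add, solid, solid]; ring⟩
    | succ k ih =>
      refine ⟨ih.2, ?_⟩
      rw [solid, solid, ih.1, ih.2]
      ring
  exact fun k => (key k).1

/-! #### Harmonic polynomials of given weight under the rotations -/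

/-- Legendre's equation in Cartesian form. With ρ² = x₁²+x₂², one has ρ²(∂₁²+∂₂²) = (ρ∂_ρ)² + rot²;
on U, ρ∂_ρ is N+1 - x₀∂₀ by Euler, and ∂₁²+∂₂² is -∂₀² by harmonicity. -/
lemma weight_identity {N : ℕ} {m : ℝ} {U : Poly} (hU : U.IsHomogeneous (N + 1)) (hl : lap U = 0)
    (hr : rot (rot U) = C (-m ^ 2) * U) :
    C (2 * (N : ℝ) + 1) * (X 0 * pderiv 0 U) - normSq * pderiv 0 (pderiv 0 U) =
      C (((N : ℝ) + 1) ^ 2 - m ^ 2) * U := by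
  have e := euler hU
  have e0 := euler (hU.pderiv (i := 0))
  have e1 := euler (hU.pderiv (i := 1))
  have e2 := euler (hU.pderiv (i := 2))
  rw [pderiv_comm 1 0, pderiv_comm 2 0] at e0
  rw [pderiv_comm 2 1] at e1
  simp only [rot, map_sub, pderiv_mul, pderiv_one_X, pderiv_two_X, pderiv_comm 2 1] at hr
  simp only [lap] at hl
  simp only [map_add, map_mul, map_ofNat, map_natCast, map_one, Nat.cast_add, Nat.cast_one,
    Nat.add_sub_cancel, map_sub, map_pow, map_neg, normSq] at *
  linear_combination (-(X 1 ^ 2 + X 2 ^ 2)) * hl + (X 1 * e1 + X 2 * e2) + hr +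
    ((N : Poly) + 1) * e - X 0 * e0

end SolidHarmonic

namespace SolidHarmonic
open MvPolynomial

/-! ### Orthogonality relations of harmonic polynomials

`J` is a linear functional on polynomials which satisfies the integration by parts formula of
the Gaussian weight `exp (-|x|²)`. -/

/-- A rotation invariant quadratic expression in two gradients. -/
def gradForm (α β : ℝ) (U W : Poly) : Poly :=
  C α * (pderiv 0 U * pderiv 0 W) + C β * (pderiv 1 U * pderiv 1 W + pderiv 2 U * pderiv 2 W)

lemma gradForm_comm (α β : ℝ) (U W : Poly) : gradForm α β U W = gradForm α β W U := by
  simp only [gradForm]; ring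

lemma gradForm_C_mul_right (α β c : ℝ) (U W : Poly) :
    gradForm α β U (C c * W) = C c * gradForm α β U W := by
  simp only [gradForm, pderiv_C_mul]; ring

lemma gradForm_C_mul_left (α β c : ℝ) (U W : Poly) :
    gradForm α β (C c * U) W = C c * gradForm α β U W := by
  simp only [gradForm, pderiv_C_mul]; ring

/-- The rotation commutes with ∂₀ and turns (∂₁, ∂₂) as a vector, so the commutator terms cancel in
∂₁U∂₁W + ∂₂U∂₂W. -/
lemma rot_gradForm (α β : ℝ) (U W : Poly) :
    rot (gradForm α β U W) = gradForm α β (rot U) W + gradForm α β U (rot W) := by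
  simp only [gradForm, rot, map_add, map_sub, pderiv_mul, pderiv_C, pderiv_zero_X, pderiv_one_X,
    pderiv_two_X, pderiv_comm 1 0, pderiv_comm 2 0, pderiv_comm 2 1]
  ring

lemma lap_pderiv (i : Fin 3) (p : Poly) : lap (pderiv i p) = pderiv i (lap p) := by
  rw [lap, lap, map_add, map_add, pderiv_comm i 0 (pderiv 0 p), pderiv_comm i 0 p,
    pderiv_comm i 1 (pderiv 1 p), pderiv_comm i 1 p, pderiv_comm i 2 (pderiv 2 p),
    pderiv_comm i 2 p]

lemma map_C_mul (J : Poly →ₗ[ℝ] ℝ) (c : ℝ) (p : Poly) : J (C c * p) = c * J p := by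
  rw [C_mul', map_smul, smul_eq_mul]

variable {J : Poly →ₗ[ℝ] ℝ}

section
variable (hJ : ∀ (j : Fin 3) (p : Poly), J (pderiv j p) = 2 * J (X j * p))
include hJ

/-- The rotation field is divergence free and tangent to the level sets of the weight. -/
lemma map_rot (p : Poly) : J (rot p) = 0 := by
  have h : rot p = pderiv 2 (X 1 * p) - pderiv 1 (X 2 * p) := by
    simp only [rot, pderiv_mul, pderiv_one_X, pderiv_two_X]; ring
  rw [h, map_sub, hJ, hJ, mul_left_comm, sub_self]

lemma map_lap {d : ℕ} {p : Poly} (hp : p.IsHomogeneous d) : J (lap p) = 2 * d * J p := by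
  have he := congrArg J (euler hp)
  simp only [map_add, map_C_mul] at he
  simp only [lap, map_add, hJ]
  linear_combination 2 * he

lemma map_normSq_mul {d : ℕ} {p : Poly} (hp : p.IsHomogeneous d) :
    2 * J (normSq * p) = (d + 3) * J p := by
  have he := congrArg J (euler hp)
  have h : ∀ j : Fin 3, 2 * J (X j * (X j * p)) = J p + J (X j * pderiv j p) := fun j => by
    rw [← hJ, pderiv_mul, pderiv_X_self, one_mul, map_add]
  simp only [map_add, map_C_mul] at he
  have e : normSq * p = X 0 * (X 0 * p) + X 1 * (X 1 * p) + X 2 * (X 2 * p) := by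
    rw [normSq]; ring
  rw [e, map_add, map_add]
  linear_combination he + h 0 + h 1 + h 2

/-- Green's identity: p∇q - q∇p is divergence free, and its product with x is (l-k)pq by Euler. -/
lemma map_mul_of_degree_ne {k l : ℕ} (hkl : k ≠ l) {p q : Poly} (hp : p.IsHomogeneous k)
    (hq : q.IsHomogeneous l) (lp : lap p = 0) (lq : lap q = 0) : J (p * q) = 0 := by
  have h1 : pderiv 0 (p * pderiv 0 q - q * pderiv 0 p) +
      pderiv 1 (p * pderiv 1 q - q * pderiv 1 p) +
      pderiv 2 (p * pderiv 2 q - q * pderiv 2 p) = 0 := by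
    simp only [lap] at lp lq
    simp only [map_sub, pderiv_mul]
    linear_combination p * lq - q * lp
  have h2 : X 0 * (p * pderiv 0 q - q * pderiv 0 p) + X 1 * (p * pderiv 1 q - q * pderiv 1 p) +
      X 2 * (p * pderiv 2 q - q * pderiv 2 p) = C ((l : ℝ) - k) * (p * q) := by
    have ep := euler hp
    have eq := euler hq
    rw [C_sub]
    linear_combination p * eq - q * ep
  have h3 := congrArg J h1
  have h4 := congrArg J h2
  simp only [map_add, hJ, map_zero, map_C_mul] at h3 h4
  have h5 : ((l : ℝ) - k) * J (p * q) = 0 := by linarith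
  exact (mul_eq_zero.1 h5).resolve_left (sub_ne_zero.2 (by exact_mod_cast hkl.symm))

/-- For harmonic U, Δ(U²) = 2|∇U|², and U² has degree 2N in `map_lap`. -/
lemma map_gradForm_one_one {N : ℕ} {U : Poly} (hU : U.IsHomogeneous N) (hl : lap U = 0) :
    J (gradForm 1 1 U U) = 2 * N * J (U * U) := by
  have h := map_lap hJ (hU.mul hU)
  have h2 : lap (U * U) = C 2 * gradForm 1 1 U U := by
    simp only [lap] at hl
    simp only [lap, gradForm, map_add, pderiv_mul, C_1, map_ofNat]
    linear_combination 2 * U * hl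
  rw [h2, map_C_mul] at h
  push_cast at h
  linarith

/-- U is orthogonal to ∂₀²U, of lower degree, so by parts J((∂₀U)²) = 2J(x₀U∂₀U). Multiplying
`weight_identity` by U evaluates the right side; its |x|² term drops for the same reason. -/
lemma map_gradForm_one_zero {N : ℕ} {m : ℝ} {U : Poly} (hU : U.IsHomogeneous (N + 1))
    (hl : lap U = 0) (hr : rot (rot U) = C (-m ^ 2) * U) :
    (2 * N + 1) * J (gradForm 1 0 U U) = 2 * (((N : ℝ) + 1) ^ 2 - m ^ 2) * J (U * U) := by
  have l0 : lap (pderiv 0 (pderiv 0 U)) = 0 := by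
    rw [lap_pderiv, lap_pderiv, hl, map_zero, map_zero]
  -- At N = 0 the truncated degree is 0, which still differs from N+1.
  have h00 : (pderiv 0 (pderiv 0 U)).IsHomogeneous (N - 1) := hU.pderiv.pderiv
  have ho : J (U * pderiv 0 (pderiv 0 U)) = 0 :=
    map_mul_of_degree_ne hJ (by omega) hU h00 hl l0
  have hw := congrArg (fun p => J (U * p)) (weight_identity hU hl hr)
  rw [mul_sub, map_sub, mul_left_comm U (C _), mul_left_comm U (C _), map_C_mul, map_C_mul,
    mul_left_comm U normSq] at hw
  have hn := map_normSq_mul hJ (hU.mul h00)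
  have hp := hJ 0 (U * pderiv 0 U)
  rw [pderiv_mul, map_add] at hp
  have e1 : gradForm 1 0 U U = pderiv 0 U * pderiv 0 U := by simp [gradForm]
  rw [ho, mul_zero] at hn
  rw [e1]
  have e2 : X 0 * (U * pderiv 0 U) = U * (X 0 * pderiv 0 U) := by ring
  rw [e2] at hp
  linear_combination (2 * (N : ℝ) + 1) * hp + 2 * hw + hn - (2 * (N : ℝ) + 1) * ho

/-- The source of the coefficient a: the form with signs (1, -1) is the integrand of ⟨conj X, X⟩,
and equals twice the ∂₀ part minus |∇U|². -/
lemma map_gradForm_weight {N : ℕ} {m : ℝ} {U : Poly} (hU : U.IsHomogeneous (N + 1))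
    (hl : lap U = 0) (hr : rot (rot U) = C (-m ^ 2) * U) :
    J (gradForm 1 (-1) U U) =
      ((N : ℝ) - 2 * m ^ 2 + 1) / (((N : ℝ) + 1) * (2 * (N : ℝ) + 1)) * J (gradForm 1 1 U U) := by
  have h1 := map_gradForm_one_one hJ hU hl
  have h2 := map_gradForm_one_zero hJ hU hl hr
  have h3 : gradForm 1 (-1) U U = C 2 * gradForm 1 0 U U - gradForm 1 1 U U := by
    simp only [gradForm, C_1, C_0, C_neg, map_ofNat]; ring
  rw [h3, map_sub, map_C_mul, h1]
  have p1 : (N : ℝ) + 1 ≠ 0 := by positivity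
  have p2 : 2 * (N : ℝ) + 1 ≠ 0 := by positivity
  push_cast
  field_simp
  linear_combination h2

lemma map_gradForm_rot (α β : ℝ) (U W : Poly) :
    J (gradForm α β (rot U) W) = -J (gradForm α β U (rot W)) := by
  have h := map_rot hJ (gradForm α β U W)
  rw [rot_gradForm, map_add] at h
  linarith

/-- Skewness lets rot² pass from one argument to the other, so distinct eigenvalues force
orthogonality. -/
lemma map_gradForm_of_weight_ne (α β : ℝ) {m l : ℝ} (hml : m ^ 2 ≠ l ^ 2) {U W : Poly}
    (hU : rot (rot U) = C (-m ^ 2) * U) (hW : rot (rot W) = C (-l ^ 2) * W) :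
    J (gradForm α β U W) = 0 := by
  have h1 := map_gradForm_rot hJ α β (rot U) W
  have h2 := map_gradForm_rot hJ α β U (rot W)
  rw [hU, gradForm_C_mul_left, map_C_mul] at h1
  rw [hW, gradForm_C_mul_right, map_C_mul] at h2
  have h5 : (m ^ 2 - l ^ 2) * J (gradForm α β U W) = 0 := by linarith
  exact (mul_eq_zero.1 h5).resolve_left (sub_ne_zero.2 hml)

/-- A skew operator sends U to something orthogonal to U. This separates cosine from sine at equal
order, where the eigenvalues of rot² coincide. -/
lemma map_gradForm_of_rot_eq (α β : ℝ) {c : ℝ} (hc : c ≠ 0) {U W : Poly}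
    (h : rot U = C c * W) : J (gradForm α β U W) = 0 := by
  have h1 := map_gradForm_rot hJ α β U U
  rw [gradForm_comm, h, gradForm_C_mul_right, map_C_mul] at h1
  have h5 : c * J (gradForm α β U W) = 0 := by linarith
  exact (mul_eq_zero.1 h5).resolve_left hc

end

end SolidHarmonic

namespace SolidHarmonic
open MvPolynomial MeasureTheory
open Ambigenic (R3)

/-! ### Polynomials as functions and their Gaussian integrals -/

/-- The polynomial function on `ℝ³` defined by `p`. -/
def ev (p : Poly) (x : R3) : ℝ := eval (fun i => x i) p

lemma ev_add (p q : Poly) : ev (p + q) = ev p + ev q := by ext x; simp [ev]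

lemma ev_sub (p q : Poly) : ev (p - q) = ev p - ev q := by ext x; simp [ev]

lemma ev_mul (p q : Poly) : ev (p * q) = ev p * ev q := by ext x; simp [ev]

lemma ev_C_mul (c : ℝ) (p : Poly) : ev (C c * p) = c • ev p := by ext x; simp [ev]

lemma ev_zero : ev 0 = 0 := by ext x; simp [ev]

lemma contDiff_ev (p : Poly) {n : WithTop ℕ∞} : ContDiff ℝ n (ev p) := by
  induction p using MvPolynomial.induction_on with
  | C a =>
    have : ev (C a) = fun _ => a := by ext x; simp [ev]
    rw [this]
    exact contDiff_const
  | add p q hp hq => rw [ev_add]; exact hp.add hq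
  | mul_X p i hp =>
    rw [ev_mul]
    refine hp.mul ?_
    have : ev (X i) = fun x : R3 => x i := by ext x; simp [ev]
    rw [this]
    fun_prop

lemma continuous_ev (p : Poly) : Continuous (ev p) := (contDiff_ev p (n := 0)).continuous

lemma differentiable_ev (p : Poly) : Differentiable ℝ (ev p) :=
  (contDiff_ev p (n := 1)).differentiable one_ne_zero

lemma fderiv_ev (p : Poly) (j : Fin 3) (x : R3) :
    fderiv ℝ (ev p) x (EuclideanSpace.single j 1) = ev (pderiv j p) x := by
  induction p using MvPolynomial.induction_on with
  | C a =>
    have : ev (C a) = fun _ => a := by ext x; simp [ev]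
    rw [this]
    simp [ev]
  | add p q hp hq =>
    rw [ev_add, fderiv_add (differentiable_ev p x) (differentiable_ev q x), map_add, ev_add]
    simp [hp, hq]
  | mul_X p i hp =>
    have h : ev (X i) = fun x : R3 => x i := by ext x; simp [ev]
    have h2 : fderiv ℝ (fun x : R3 => x i) x (EuclideanSpace.single j 1) =
        (EuclideanSpace.single j (1 : ℝ) : R3) i := by
      have := (EuclideanSpace.proj i : R3 →L[ℝ] ℝ).hasFDerivAt (x := x)
      have e : (fun x : R3 => x i) = (EuclideanSpace.proj i : R3 →L[ℝ] ℝ) := by ext x; simp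
      rw [e, this.fderiv]
      simp
    rw [ev_mul, fderiv_mul (differentiable_ev p x) (differentiable_ev _ x), pderiv_mul, ev_add,
      ev_mul, ev_mul, h]
    simp only [add_apply, smul_apply, hp, h2, smul_eq_mul,
      Pi.add_apply, Pi.mul_apply, pderiv_X]
    rcases eq_or_ne i j with rfl | hij
    · simp [ev]; ring
    · simp [ev, hij]; ring

lemma ev_smul {d : ℕ} {p : Poly} (hp : p.IsHomogeneous d) (t : ℝ) (x : R3) :
    ev p (t • x) = t ^ d * ev p x := by
  rw [ev, ev, eval_eq', eval_eq', Finset.mul_sum]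
  refine Finset.sum_congr rfl fun s hs => ?_
  have h := hp (mem_support_iff.1 hs)
  rw [Finsupp.weight_apply, Finsupp.sum_fintype _ _ (by simp)] at h
  simp only [Pi.one_apply, smul_eq_mul, mul_one] at h
  simp only [PiLp.smul_apply, smul_eq_mul, mul_pow, Finset.prod_mul_distrib]
  rw [Finset.prod_pow_eq_pow_sum, h]
  ring

lemma abs_apply_le_norm (x : R3) (i : Fin 3) : |x i| ≤ ‖x‖ := by
  simpa using PiLp.norm_apply_le x i

lemma exists_abs_ev_le (p : Poly) :
    ∃ c k : ℝ, 0 ≤ c ∧ 0 ≤ k ∧ ∀ x, |ev p x| ≤ c * Real.exp (k * ‖x‖) := by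
  induction p using MvPolynomial.induction_on with
  | C a => exact ⟨|a|, 0, abs_nonneg _, le_rfl, fun x => by simp [ev]⟩
  | add p q hp hq =>
    obtain ⟨c, k, hc, hk, h⟩ := hp
    obtain ⟨c', k', hc', hk', h'⟩ := hq
    refine ⟨c + c', max k k', add_nonneg hc hc', hk.trans (le_max_left _ _), fun x => ?_⟩
    rw [ev_add, add_mul]
    refine (abs_add_le _ _).trans (add_le_add ((h x).trans ?_) ((h' x).trans ?_))
    · gcongr; exact le_max_left _ _
    · gcongr; exact le_max_right _ _
  | mul_X p i hp =>
    obtain ⟨c, k, hc, hk, h⟩ := hp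
    refine ⟨c, k + 1, hc, by linarith, fun x => ?_⟩
    rw [ev_mul, Pi.mul_apply, abs_mul, add_mul, Real.exp_add, ← mul_assoc, one_mul]
    refine mul_le_mul (h x) ?_ (abs_nonneg _) (by positivity)
    have : ev (X i) x = x i := by simp [ev]
    rw [this]
    linarith [abs_apply_le_norm x i, Real.add_one_le_exp ‖x‖]

/-- The Gaussian weight. -/
def gauss (x : R3) : ℝ := Real.exp (-‖x‖ ^ 2)

lemma contDiff_gauss : ContDiff ℝ 1 gauss := by
  unfold gauss
  exact Real.contDiff_exp.comp (contDiff_norm_sq ℝ).neg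

lemma integrable_exp_neg_half : Integrable fun x : R3 => Real.exp (-(1 / 2) * ‖x‖ ^ 2) := by
  have h := (GaussianFourier.integrable_cexp_neg_mul_sq_norm_add (V := R3) (b := 1 / 2)
    (by norm_num) 0 0).norm
  refine h.congr (Filter.Eventually.of_forall fun x => ?_)
  simp only [Complex.norm_exp]
  congr 1
  have : (-(1 / 2 : ℂ) * (‖x‖ : ℂ) ^ 2 + 0 * ((inner ℝ (0 : R3) x : ℝ) : ℂ)) =
    ((-(1 / 2) * ‖x‖ ^ 2 : ℝ) : ℂ) := by push_cast; ring
  rw [this, Complex.ofReal_re]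

lemma integrable_mul_gauss {f : R3 → ℝ} (hf : Continuous f) {c k : ℝ}
    (h : ∀ x, |f x| ≤ c * Real.exp (k * ‖x‖)) : Integrable fun x => f x * gauss x := by
  refine (integrable_exp_neg_half.const_mul (c * Real.exp (k ^ 2 / 2))).mono'
    (hf.mul contDiff_gauss.continuous).aestronglyMeasurable (Filter.Eventually.of_forall fun x => ?_)
  have hc : 0 ≤ c := by
    have := (abs_nonneg _).trans (h 0)
    simpa using this
  rw [Real.norm_eq_abs, abs_mul, gauss, Real.abs_exp]
  calc |f x| * Real.exp (-‖x‖ ^ 2) ≤ c * Real.exp (k * ‖x‖) * Real.exp (-‖x‖ ^ 2) := by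
        gcongr; exact h x
    _ = c * Real.exp (k * ‖x‖ + -‖x‖ ^ 2) := by rw [Real.exp_add, mul_assoc]
    -- By (k - ‖x‖)² ≥ 0, half of the Gaussian exponent absorbs the growth exp(k‖x‖).
    _ ≤ c * Real.exp (k ^ 2 / 2 + -(1 / 2) * ‖x‖ ^ 2) := by
        refine mul_le_mul_of_nonneg_left (Real.exp_le_exp.2 ?_) hc
        nlinarith [sq_nonneg (k - ‖x‖)]
    _ = _ := by rw [Real.exp_add, mul_assoc]

lemma integrable_ev_mul_gauss (p : Poly) : Integrable fun x => ev p x * gauss x := by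
  obtain ⟨c, k, -, -, h⟩ := exists_abs_ev_le p
  exact integrable_mul_gauss (continuous_ev p) h

/-- The integral of a polynomial against the Gaussian weight. -/
def gaussIntegral : Poly →ₗ[ℝ] ℝ where
  toFun p := ∫ x, ev p x * gauss x
  map_add' p q := by
    simp only [ev_add, Pi.add_apply, add_mul]
    exact integral_add (integrable_ev_mul_gauss p) (integrable_ev_mul_gauss q)
  map_smul' c p := by
    simp only [← C_mul', ev_C_mul, Pi.smul_apply, smul_eq_mul, mul_assoc, RingHom.id_apply]
    exact integral_const_mul _ _

lemma fderiv_gauss (x : R3) (j : Fin 3) :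
    fderiv ℝ gauss x (EuclideanSpace.single j 1) = -(2 * x j) * gauss x := by
  have h : HasFDerivAt gauss _ x :=
    (hasStrictFDerivAt_norm_sq x).hasFDerivAt.neg.exp
  rw [h.fderiv]
  simp [gauss, EuclideanSpace.inner_single_right]
  ring

lemma gaussIntegral_pderiv (j : Fin 3) (p : Poly) :
    gaussIntegral (pderiv j p) = 2 * gaussIntegral (X j * p) := by
  have hX : ∀ x : R3, ev (C 2 * (X j * p)) x = 2 * x j * ev p x := fun x => by
    rw [ev_C_mul, ev_mul]; simp [ev]; ring
  have h := integral_mul_fderiv_eq_neg_fderiv_mul_of_integrable (μ := (volume : Measure R3))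
    (f := ev p) (g := gauss) (v := EuclideanSpace.single j 1)
    (by simpa only [fderiv_ev] using integrable_ev_mul_gauss (pderiv j p))
    (by
      refine (integrable_ev_mul_gauss (C 2 * (X j * p))).neg.congr
        (Filter.Eventually.of_forall fun x => ?_)
      simp only [Pi.neg_apply, hX, fderiv_gauss]
      ring)
    (integrable_ev_mul_gauss p) (fun x _ => differentiable_ev p x)
    (fun x _ => contDiff_gauss.differentiable one_ne_zero x)
  simp only [fderiv_ev, fderiv_gauss] at h
  rw [← map_C_mul]
  simp only [gaussIntegral, LinearMap.coe_mk, AddHom.coe_mk, hX]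
  rw [eq_comm, ← neg_inj, ← h, ← integral_neg]
  congr 1
  ext x
  ring

/-! ### Integration in polar coordinates -/

/-- The radial weight g is left free so that the Gaussian and the indicator of the ball share the
same spherical factor. -/
lemma integral_homogeneous_mul_norm {d : ℕ} {F : R3 → ℝ}
    (hF : ∀ t : ℝ, 0 < t → ∀ x, F (t • x) = t ^ d * F x) (g : ℝ → ℝ) :
    ∫ x, F x * g ‖x‖ = (∫ w : Metric.sphere (0 : R3) 1, F w ∂(volume : Measure R3).toSphere) *
      ∫ r : Set.Ioi (0 : ℝ), (r : ℝ) ^ d * g r ∂Measure.volumeIoiPow 2 := by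
  have hd : Module.finrank ℝ R3 - 1 = 2 := by simp
  rw [← integral_prod_mul, ← hd,
    ← (volume : Measure R3).measurePreserving_homeomorphUnitSphereProd.integral_comp
      (Homeomorph.measurableEmbedding _),
    ← restrict_compl_singleton (μ := (volume : Measure R3)) 0,
    ← integral_subtype_comap (measurableSet_singleton (0 : R3)).compl,
    restrict_compl_singleton]
  refine integral_congr_ae (Filter.Eventually.of_forall fun x => ?_)
  have hx : 0 < ‖(x : R3)‖ := norm_pos_iff.2 x.2
  simp only [homeomorphUnitSphereProd_apply_snd_coe, homeomorphUnitSphereProd_apply_fst_coe]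
  rw [← mul_assoc, mul_comm (F (_ • _)), ← hF _ hx, smul_smul, mul_inv_cancel₀ hx.ne', one_smul]

lemma integral_ball_eq_zero {d : ℕ} {p : Poly} (hp : p.IsHomogeneous d)
    (h : gaussIntegral p = 0) : ∫ x in Metric.ball (0 : R3) 1, ev p x = 0 := by
  have hF : ∀ t : ℝ, 0 < t → ∀ x, ev p (t • x) = t ^ d * ev p x := fun t _ x => ev_smul hp t x
  have hn : ∀ t : ℝ, 0 < t → ∀ x : R3, ‖t • x‖ ^ d = t ^ d * ‖x‖ ^ d := fun t ht x => by
    rw [norm_smul, mul_pow, Real.norm_of_nonneg ht.le]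
  have h1 := integral_homogeneous_mul_norm hF fun r => Real.exp (-r ^ 2)
  have h2 := integral_homogeneous_mul_norm (F := fun x => ‖x‖ ^ d) hn fun r => Real.exp (-r ^ 2)
  have h3 := integral_homogeneous_mul_norm hF ((Set.Iio 1).indicator fun _ => 1)
  -- Splitting this positive integral shows that the radial Gaussian factor is nonzero, so the
  -- spherical integral of p must vanish.
  have hpos : 0 < ∫ x : R3, ‖x‖ ^ d * gauss x := by
    have hc : Continuous fun x : R3 => ‖x‖ ^ d := by fun_prop
    refine integral_pos_of_integrable_nonneg_nonzero (hc.mul contDiff_gauss.continuous)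
      (x := EuclideanSpace.single 0 1) ?_ ?_ ?_
    · refine integrable_mul_gauss hc (c := 1) (k := d) fun x => ?_
      rw [abs_of_nonneg (by positivity), one_mul, Real.exp_nat_mul]
      gcongr
      linarith [Real.add_one_le_exp ‖x‖]
    · exact fun x => mul_nonneg (by positivity) (Real.exp_pos _).le
    · simp [gauss]
  have h0 : gaussIntegral p = ∫ x : R3, ev p x * Real.exp (-‖x‖ ^ 2) := rfl
  have hpos' : 0 < ∫ x : R3, ‖x‖ ^ d * Real.exp (-‖x‖ ^ 2) := hpos
  rw [h2] at hpos'
  rw [← h0, h] at h1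
  have h4 := (mul_eq_zero.1 h1.symm).resolve_right (right_ne_zero_of_mul hpos'.ne')
  rw [h4, zero_mul] at h3
  rw [← h3, ← integral_indicator measurableSet_ball]
  congr 1
  ext x
  by_cases hx : ‖x‖ < 1 <;> simp [Set.indicator, hx]

end SolidHarmonic

namespace SolidHarmonic
open MvPolynomial
open Ambigenic (R3 legendreP assocLegendre azimuth solidU solidV)

/-! ### The solid harmonics `Û^n_m` and `V̂^n_m` are harmonic polynomials -/

/-- The solid harmonic of degree `n` with sectorial factor `h` of degree `m`. -/
def zonalMul (n m : ℕ) (h : Poly) : Poly :=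
  if m ≤ n then C (sectorialCoeff m) * solid m h (n - m) else 0

/-- The polynomial `Û^n_m`. -/
def polyU (n m : ℕ) : Poly := zonalMul n m (cosSin m).1

/-- The polynomial `V̂^n_m`. -/
def polyV (n m : ℕ) : Poly := zonalMul n m (cosSin m).2

lemma zonalMul_of_lt {n m : ℕ} (hnm : n < m) (h : Poly) : zonalMul n m h = 0 :=
  if_neg (not_le.2 hnm)

lemma zonalMul_add (m k : ℕ) (h : Poly) :
    zonalMul (m + k) m h = C (sectorialCoeff m) * solid m h k := by
  rw [zonalMul, if_pos (Nat.le_add_right m k), Nat.add_sub_cancel_left]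

lemma isHomogeneous_zonalMul {n m : ℕ} {h : Poly} (hh : h.IsHomogeneous m) :
    (zonalMul n m h).IsHomogeneous n := by
  rcases lt_or_ge n m with hnm | hnm
  · rw [zonalMul_of_lt hnm]; exact isHomogeneous_zero _ _ _
  · obtain ⟨k, rfl⟩ := Nat.exists_eq_add_of_le hnm
    rw [zonalMul_add]
    exact isHomogeneous_C_mul _ (isHomogeneous_solid hh k)

lemma lap_zonalMul {n m : ℕ} {h : Poly} (hh : h.IsHomogeneous m) (h0 : pderiv 0 h = 0)
    (hl : lap h = 0) : lap (zonalMul n m h) = 0 := by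
  rcases lt_or_ge n m with hnm | hnm
  · rw [zonalMul_of_lt hnm]; simp [lap]
  · obtain ⟨k, rfl⟩ := Nat.exists_eq_add_of_le hnm
    rw [zonalMul_add, lap_C_mul, lap_solid hh h0 hl, mul_zero]

/-- The value 0 for m > n makes the relation uniform: at m = n+1 the left side is sectorial, hence
independent of x₀. -/
lemma pderiv_zero_zonalMul {n m : ℕ} {h : Poly} (h0 : pderiv 0 h = 0) :
    pderiv 0 (zonalMul (n + 1) m h) = C ((n : ℝ) + 1 + m) * zonalMul n m h := by
  rcases lt_or_ge n m with hnm | hnm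
  · rw [zonalMul_of_lt hnm, mul_zero]
    rcases Nat.lt_or_ge (n + 1) m with h1 | h1
    · rw [zonalMul_of_lt h1, map_zero]
    · obtain rfl : m = n + 1 := by omega
      have := zonalMul_add (n + 1) 0 h
      rw [add_zero] at this
      rw [this, pderiv_C_mul, solid, h0, mul_zero]
  · obtain ⟨k, rfl⟩ := Nat.exists_eq_add_of_le hnm
    rw [add_assoc, zonalMul_add, zonalMul_add, pderiv_C_mul, pderiv_zero_solid h0,
      mul_left_comm]
    congr 2
    push_cast
    ring

lemma rot_zonalMul (n m : ℕ) (h : Poly) : rot (zonalMul n m h) = zonalMul n m (rot h) := by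
  rw [zonalMul, zonalMul]
  split_ifs
  · rw [rot_C_mul, rot_solid]
  · simp [rot]

lemma zonalMul_C_mul (n m : ℕ) (c : ℝ) (h : Poly) :
    zonalMul n m (C c * h) = C c * zonalMul n m h := by
  rw [zonalMul, zonalMul]
  split_ifs
  · rw [solid_C_mul]; ring
  · simp

lemma isHomogeneous_polyU (n m : ℕ) : (polyU n m).IsHomogeneous n :=
  isHomogeneous_zonalMul (isHomogeneous_cosSin m).1

lemma isHomogeneous_polyV (n m : ℕ) : (polyV n m).IsHomogeneous n :=
  isHomogeneous_zonalMul (isHomogeneous_cosSin m).2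

lemma lap_polyU (n m : ℕ) : lap (polyU n m) = 0 :=
  lap_zonalMul (isHomogeneous_cosSin m).1 (pderiv_zero_cosSin m).1 (lap_cosSin m).1

lemma lap_polyV (n m : ℕ) : lap (polyV n m) = 0 :=
  lap_zonalMul (isHomogeneous_cosSin m).2 (pderiv_zero_cosSin m).2 (lap_cosSin m).2

lemma pderiv_zero_polyU (n m : ℕ) :
    pderiv 0 (polyU (n + 1) m) = C ((n : ℝ) + 1 + m) * polyU n m :=
  pderiv_zero_zonalMul (pderiv_zero_cosSin m).1

lemma pderiv_zero_polyV (n m : ℕ) :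
    pderiv 0 (polyV (n + 1) m) = C ((n : ℝ) + 1 + m) * polyV n m :=
  pderiv_zero_zonalMul (pderiv_zero_cosSin m).2

lemma rot_polyU (n m : ℕ) : rot (polyU n m) = C (-(m : ℝ)) * polyV n m := by
  rw [polyU, rot_zonalMul, (rot_cosSin m).1, zonalMul_C_mul, polyV]

lemma rot_polyV (n m : ℕ) : rot (polyV n m) = C (m : ℝ) * polyU n m := by
  rw [polyV, rot_zonalMul, (rot_cosSin m).2, zonalMul_C_mul, polyU]

lemma rot_rot_polyU (n m : ℕ) : rot (rot (polyU n m)) = C (-(m : ℝ) ^ 2) * polyU n m := by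
  rw [rot_polyU, rot_C_mul, rot_polyV, ← mul_assoc, ← C_mul]
  congr 2; ring

lemma rot_rot_polyV (n m : ℕ) : rot (rot (polyV n m)) = C (-(m : ℝ) ^ 2) * polyV n m := by
  rw [rot_polyV, rot_C_mul, rot_polyU, ← mul_assoc, ← C_mul]
  congr 2; ring

lemma polyU_self (m : ℕ) : polyU m m = C (sectorialCoeff m) * (cosSin m).1 := by
  simpa [solid, polyU] using zonalMul_add m 0 (cosSin m).1

lemma polyV_self (m : ℕ) : polyV m m = C (sectorialCoeff m) * (cosSin m).2 := by
  simpa [solid, polyV] using zonalMul_add m 0 (cosSin m).2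

lemma polyV_zero (n : ℕ) : polyV n 0 = 0 := by
  have h2 := zonalMul_C_mul n 0 0 1
  simpa [polyV, cosSin] using h2

lemma C_mul_eq_zero {c : ℝ} (hc : c ≠ 0) {p : Poly} (h : C c * p = 0) : p = 0 :=
  C_mul_cancel hc (by rw [h, mul_zero])

/-- ∂₀ lowers the degree with nonzero factors down to the sectorial case, which is tested at (0, 1,
0). -/
lemma polyU_ne_zero {n m : ℕ} (hnm : m ≤ n) : polyU n m ≠ 0 := by
  induction n, hnm using Nat.le_induction with
  | base =>
    intro h
    rw [polyU_self] at h
    have h1 := C_mul_eq_zero (sectorialCoeff_ne_zero m) h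
    have h2 : ∀ k, eval ![0, 1, 0] (cosSin k).1 = (1 : ℝ) ∧ eval ![0, 1, 0] (cosSin k).2 = (0 : ℝ)
        := by
      intro k
      induction k with
      | zero => simp [cosSin]
      | succ k ih => simp [cosSin, ih]
    have h3 := (h2 m).1
    rw [h1] at h3
    simp at h3
  | succ n _ ih =>
    intro h
    have h1 := pderiv_zero_polyU n m
    rw [h, map_zero] at h1
    exact ih (C_mul_eq_zero (by positivity) h1.symm)

lemma polyV_ne_zero {n m : ℕ} (hm : m ≠ 0) (hnm : m ≤ n) : polyV n m ≠ 0 := by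
  intro h
  have h1 := rot_polyV n m
  rw [h] at h1
  have h2 : rot 0 = 0 := by simp [rot]
  rw [h2] at h1
  exact polyU_ne_zero hnm (C_mul_eq_zero (by exact_mod_cast hm) h1.symm)

lemma ev_cosSin (m : ℕ) (x : R3) :
    ev (cosSin m).1 x = ((⟨x 1, x 2⟩ : ℂ) ^ m).re ∧ ev (cosSin m).2 x = ((⟨x 1, x 2⟩ : ℂ) ^ m).im := by
  induction m with
  | zero => simp [cosSin, ev]
  | succ m ih =>
    rw [cosSin, ev_sub, ev_add, ev_mul, ev_mul, ev_mul, ev_mul, pow_succ]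
    simp only [Pi.sub_apply, Pi.add_apply, Pi.mul_apply, ih, Complex.mul_re, Complex.mul_im]
    simp only [ev, eval_X]
    constructor <;> ring

lemma norm_mul_sqrt (x : R3) :
    ‖x‖ * √(1 - (x 0 / ‖x‖) ^ 2) = ‖(⟨x 1, x 2⟩ : ℂ)‖ := by
  rcases eq_or_ne x 0 with rfl | hx
  · have : (⟨0, 0⟩ : ℂ) = 0 := rfl
    simp [this]
  · have hx' : 0 < ‖x‖ := norm_pos_iff.2 hx
    have h := EuclideanSpace.real_norm_sq_eq x
    rw [Fin.sum_univ_three] at h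
    calc ‖x‖ * √(1 - (x 0 / ‖x‖) ^ 2) = √(‖x‖ ^ 2) * √(1 - (x 0 / ‖x‖) ^ 2) := by
          rw [Real.sqrt_sq hx'.le]
      _ = √(‖x‖ ^ 2 * (1 - (x 0 / ‖x‖) ^ 2)) := (Real.sqrt_mul (sq_nonneg _) _).symm
      _ = √(x 1 ^ 2 + x 2 ^ 2) := by
          congr 1
          field_simp
          linarith
      _ = _ := by rw [Complex.norm_eq_sqrt_sq_add_sq]

/-- De Moivre for z = x₁ + i x₂. The polar form also holds at z = 0 with the default argument, so
the axis needs no separate case. -/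
lemma norm_pow_mul_cos_sin (m : ℕ) (x : R3) :
    (‖x‖ * √(1 - (x 0 / ‖x‖) ^ 2)) ^ m * Real.cos (m * azimuth x) = ev (cosSin m).1 x ∧
    (‖x‖ * √(1 - (x 0 / ‖x‖) ^ 2)) ^ m * Real.sin (m * azimuth x) = ev (cosSin m).2 x := by
  rw [norm_mul_sqrt, (ev_cosSin m x).1, (ev_cosSin m x).2, azimuth]
  set z : ℂ := ⟨x 1, x 2⟩
  have h : z ^ m = (‖z‖ ^ m : ℝ) * Complex.exp ((m * z.arg : ℝ) * Complex.I) := by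
    conv_lhs => rw [← Complex.norm_mul_exp_arg_mul_I z]
    rw [mul_pow, ← Complex.exp_nat_mul]
    push_cast
    ring_nf
  rw [h, Complex.re_ofReal_mul, Complex.im_ofReal_mul, Complex.exp_ofReal_mul_I_re,
    Complex.exp_ofReal_mul_I_im]
  exact ⟨rfl, rfl⟩

lemma ev_normSq (x : R3) : ev normSq x = ‖x‖ ^ 2 := by
  rw [EuclideanSpace.real_norm_sq_eq, Fin.sum_univ_three]
  simp [ev, normSq]

/-- Both sides have the same two initial values and the same recursion, with x₀ = ‖x‖t. -/
lemma ev_solid (m : ℕ) (h : Poly) {x : R3} (hx : x ≠ 0) : ∀ k,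
    sectorialCoeff m * ev (solid m h k) x =
      ‖x‖ ^ k * (Polynomial.derivative^[m] (legendreP (m + k))).eval (x 0 / ‖x‖) * ev h x := by
  have hx' : ‖x‖ ≠ 0 := norm_ne_zero_iff.2 hx
  have ht : x 0 = ‖x‖ * (x 0 / ‖x‖) := by field_simp
  have eX : ∀ p, ev (X 0 * p) x = x 0 * ev p x := fun p => by rw [ev_mul]; simp [ev]
  set t := x 0 / ‖x‖
  have key : ∀ k,
      (sectorialCoeff m * ev (solid m h k) x =
        ‖x‖ ^ k * (Polynomial.derivative^[m] (legendreP (m + k))).eval t * ev h x) ∧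
      (sectorialCoeff m * ev (solid m h (k + 1)) x =
        ‖x‖ ^ (k + 1) * (Polynomial.derivative^[m] (legendreP (m + (k + 1)))).eval t *
          ev h x) := by
    intro k
    induction k with
    | zero =>
      constructor
      · simp [solid, iterate_derivative_legendreP_self]
      · rw [zero_add, iterate_derivative_legendreP_succ_self, solid, ev_C_mul]
        simp only [Pi.smul_apply, smul_eq_mul, eX, Polynomial.eval_mul, Polynomial.eval_C,
          Polynomial.eval_X]
        rw [ht]
        ring
    | succ k ih =>
      refine ⟨ih.2, ?_⟩
      have r1 := congrArg (fun p => ev p x) (solid_add_two m h k)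
      have r2 := congrArg (Polynomial.eval t) (iterate_derivative_legendreP_add_two (m + k) m)
      simp only [ev_C_mul, ev_sub, Pi.sub_apply, Pi.smul_apply, smul_eq_mul, eX] at r1
      rw [ev_mul, Pi.mul_apply, ev_normSq, ht] at r1
      simp only [Polynomial.eval_mul, Polynomial.eval_C, Polynomial.eval_X,
        Polynomial.eval_sub] at r2
      obtain ⟨i1, i2⟩ := ih
      rw [show m + k + 1 = m + (k + 1) by ring, show m + k + 2 = m + (k + 1 + 1) by ring] at r2
      push_cast at r2
      have hk : (k : ℝ) + 2 ≠ 0 := by positivity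
      apply mul_left_cancel₀ hk
      rw [show k + 1 + 1 = k + 2 by ring] at *
      linear_combination sectorialCoeff m * r1 + (2 * (m + k + 1 : ℝ) + 1) * ‖x‖ * t * i2 -
        (k + 1 + 2 * m : ℝ) * ‖x‖ ^ 2 * i1 - ‖x‖ ^ (k + 2) * ev h x * r2
  exact fun k => (key k).1

lemma ev_zonalMul (n m : ℕ) {h : Poly} {x : R3} (hx : x ≠ 0) {c : ℝ}
    (hc : (‖x‖ * √(1 - (x 0 / ‖x‖) ^ 2)) ^ m * c = ev h x) :
    ‖x‖ ^ n * assocLegendre n m (x 0 / ‖x‖) * c = ev (zonalMul n m h) x := by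
  rcases lt_or_ge n m with hnm | hnm
  · rw [zonalMul_of_lt hnm, assocLegendre, iterate_derivative_legendreP_of_lt hnm]
    simp [ev]
  · obtain ⟨k, rfl⟩ := Nat.exists_eq_add_of_le hnm
    rw [zonalMul_add, ev_C_mul, Pi.smul_apply, smul_eq_mul, ev_solid m h hx, assocLegendre, ← hc]
    ring

lemma ev_eq_zero_of_pos {n : ℕ} (hn : n ≠ 0) {p : Poly} (hp : p.IsHomogeneous n) :
    ev p 0 = 0 := by
  have := ev_smul hp 0 0
  simpa [hn] using this

lemma solidU_eq {n : ℕ} (hn : n ≠ 0) (m : ℕ) : solidU n m = ev (polyU n m) := by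
  ext x
  rcases eq_or_ne x 0 with rfl | hx
  · rw [ev_eq_zero_of_pos hn (isHomogeneous_polyU n m)]
    simp [solidU, hn]
  · exact ev_zonalMul n m hx (norm_pow_mul_cos_sin m x).1

lemma solidV_eq {n : ℕ} (hn : n ≠ 0) (m : ℕ) : solidV n m = ev (polyV n m) := by
  ext x
  rcases eq_or_ne x 0 with rfl | hx
  · rw [ev_eq_zero_of_pos hn (isHomogeneous_polyV n m)]
    simp [solidV, hn]
  · exact ev_zonalMul n m hx (norm_pow_mul_cos_sin m x).2

end SolidHarmonic

namespace SolidHarmonic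
open MeasureTheory
open scoped ContDiff
open Ambigenic (R3)

/-! ### Partial derivatives of real functions on `ℝ³` -/

/-- The partial derivative `∂_j u`. -/
def pd (j : Fin 3) (u : R3 → ℝ) (x : R3) : ℝ := fderiv ℝ u x (EuclideanSpace.single j 1)

lemma fderiv_apply_eq_sum_pd (u : R3 → ℝ) (x v : R3) : fderiv ℝ u x v = ∑ i, v i * pd i u x := by
  conv_lhs => rw [← (EuclideanSpace.basisFun (Fin 3) ℝ).sum_repr v]
  simp [pd]

lemma contDiffAt_pd {n m : WithTop ℕ∞} {u : R3 → ℝ} {x : R3} (j : Fin 3)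
    (hu : ContDiffAt ℝ n u x) (h : m + 1 ≤ n) : ContDiffAt ℝ m (pd j u) x :=
  (hu.fderiv_right h).clm_apply contDiffAt_const

lemma contDiff_pd {n m : WithTop ℕ∞} {u : R3 → ℝ} (j : Fin 3) (hu : ContDiff ℝ n u)
    (h : m + 1 ≤ n) : ContDiff ℝ m (pd j u) :=
  (hu.fderiv_right h).clm_apply contDiff_const

lemma pd_pd_comm {u : R3 → ℝ} {x : R3} (hu : ContDiffAt ℝ 2 u x) (i j : Fin 3) :
    pd i (pd j u) x = pd j (pd i u) x := by
  have hd : DifferentiableAt ℝ (fderiv ℝ u) x :=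
    (hu.fderiv_right (m := 1) (by norm_num)).differentiableAt one_ne_zero
  have h : ∀ k l : Fin 3, pd k (pd l u) x =
      fderiv ℝ (fderiv ℝ u) x (EuclideanSpace.single k 1) (EuclideanSpace.single l 1) := by
    intro k l
    have e : pd l u = fun y => fderiv ℝ u y (EuclideanSpace.single l 1) := rfl
    rw [pd, e, fderiv_clm_apply hd (differentiableAt_const _)]
    simp
  rw [h, h]
  exact (hu.isSymmSndFDerivAt (by simp)).eq _ _

lemma pd_congr {u v : R3 → ℝ} {x : R3} (h : u =ᶠ[nhds x] v) (j : Fin 3) : pd j u x = pd j v x := by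
  rw [pd, pd, h.fderiv_eq]

/-! ### Regularity of divergence free and curl free fields -/

/-- Take Φ(y) = η(|y|²) and φ = 2η'(|y|²) with η decreasing and zero beyond 1. The identity ∇Φ = yφ
will turn a radial derivative weighted by φ into a pairing with ∇Φ. -/
lemma exists_radial_mollifier : ∃ Φ φ : R3 → ℝ, ContDiff ℝ ∞ Φ ∧ ContDiff ℝ ∞ φ ∧
    (∀ y, 1 < ‖y‖ → Φ y = 0) ∧ (∀ y, 1 < ‖y‖ → φ y = 0) ∧ (∀ i y, pd i Φ y = y i * φ y) ∧
    ∫ y, φ y ≠ 0 := by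
  set η : ℝ → ℝ := fun s => expNegInvGlue (1 - s) with hη
  have hηs : ContDiff ℝ ∞ η := expNegInvGlue.contDiff.comp (contDiff_const.sub contDiff_id)
  have hη' : ContDiff ℝ ∞ (deriv η) := (contDiff_infty_iff_deriv.1 hηs).2
  have hη0 : ∀ s, 1 ≤ s → η s = 0 := fun s hs => expNegInvGlue.zero_of_nonpos (by linarith)
  have hη1 : ∀ s, 1 < s → deriv η s = 0 := fun s hs => by
    have : η =ᶠ[nhds s] fun _ => 0 := by
      filter_upwards [lt_mem_nhds hs] with t ht using hη0 t ht.le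
    rw [this.deriv_eq, deriv_const]
  have hn : ContDiff ℝ ∞ fun y : R3 => ‖y‖ ^ 2 := contDiff_norm_sq ℝ
  have hsq : ∀ y : R3, 1 < ‖y‖ → 1 < ‖y‖ ^ 2 := fun y hy => by nlinarith
  have hφ : ContDiff ℝ ∞ fun y : R3 => 2 * deriv η (‖y‖ ^ 2) :=
    contDiff_const.mul (hη'.comp hn)
  refine ⟨fun y => η (‖y‖ ^ 2), fun y => 2 * deriv η (‖y‖ ^ 2), hηs.comp hn,
    hφ, fun y hy => hη0 _ (hsq y hy).le, fun y hy => ?_, fun i y => ?_, ?_⟩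
  · change 2 * deriv η (‖y‖ ^ 2) = 0
    rw [hη1 _ (hsq y hy), mul_zero]
  · have h0 : HasDerivAt η (deriv η (‖y‖ ^ 2)) (‖y‖ ^ 2) :=
      (hηs.differentiable (by simp) _).hasDerivAt
    have h1 := (HasDerivAt.comp_hasFDerivAt (h₂ := η) y h0
      (hasStrictFDerivAt_norm_sq y).hasFDerivAt).fderiv
    rw [Function.comp_def] at h1
    rw [pd, h1]
    simp [EuclideanSpace.inner_single_right]
    ring
  -- φ ≤ 0 everywhere, and φ ≠ 0 where |y|² = c, since η drops from η(0) > 0 to η(1) = 0.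
  · obtain ⟨c, hc, hcd⟩ := exists_deriv_eq_slope η (zero_lt_one' ℝ)
      hηs.continuous.continuousOn (hηs.differentiable (by simp)).differentiableOn
    have hc0 : deriv η c ≠ 0 := by
      rw [hcd, hη0 1 le_rfl]
      have : 0 < η 0 := expNegInvGlue.pos_of_pos (by norm_num)
      simp [this.ne']
    have hpos : 0 < ∫ y : R3, -(2 * deriv η (‖y‖ ^ 2)) := by
      refine hφ.continuous.neg.integral_pos_of_hasCompactSupport_nonneg_nonzero
        (x := EuclideanSpace.single 0 (√c)) ?_ (fun y => ?_) ?_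
      · refine HasCompactSupport.intro (isCompact_closedBall (0 : R3) 1) fun y hy => ?_
        rw [mem_closedBall_zero_iff, not_le] at hy
        simp [hη1 _ (hsq y hy)]
      · have : Antitone η := fun s t hst => expNegInvGlue.monotone (by linarith)
        have := this.deriv_nonpos (x := ‖y‖ ^ 2)
        simp only [Pi.zero_apply]
        linarith
      · simp [Real.sq_sqrt hc.1.le, hc0]
    rw [integral_neg] at hpos
    linarith

lemma integral_mul_pd_eq_neg {f g : R3 → ℝ} (hf : ContDiff ℝ 1 f) (hg : ContDiff ℝ 1 g)
    (hgc : HasCompactSupport g) (j : Fin 3) :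
    ∫ y, f y * pd j g y = -∫ y, pd j f y * g y := by
  have hf' := (contDiff_pd j hf (m := 0) (by norm_num)).continuous
  have hg' := (contDiff_pd j hg (m := 0) (by norm_num)).continuous
  refine integral_mul_fderiv_eq_neg_fderiv_mul_of_integrable ?_ ?_ ?_
    (fun x _ => hf.differentiable one_ne_zero x) (fun x _ => hg.differentiable one_ne_zero x)
  · exact (hf'.mul hg.continuous).integrable_of_hasCompactSupport hgc.mul_left
  · exact (hf.continuous.mul hg').integrable_of_hasCompactSupport (hgc.fderiv_apply ℝ _).mul_left
  · exact (hf.continuous.mul hg.continuous).integrable_of_hasCompactSupport hgc.mul_left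

lemma pd_comp_add_smul {g : R3 → ℝ} (hg : Differentiable ℝ g) (x y : R3) (t : ℝ) (i : Fin 3) :
    pd i (fun z => g (x + t • z)) y = t * pd i g (x + t • y) := by
  have h1 : HasFDerivAt (fun z : R3 => x + t • z) (t • ContinuousLinearMap.id ℝ R3) y :=
    ((hasFDerivAt_id y).const_smul t).const_add x
  have h2 := (hg (x + t • y)).hasFDerivAt.comp y h1
  have h3 : fderiv ℝ (fun z => g (x + t • z)) y = _ := h2.fderiv
  rw [pd, h3]
  simp [pd]

section
variable {g : Fin 3 → R3 → ℝ} (hg : ∀ k, ContDiff ℝ 1 (g k))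
  (hgc : ∀ k, HasCompactSupport (g k)) {Φ φ : R3 → ℝ} (hΦ : ContDiff ℝ ∞ Φ)
  (hφ : ContDiff ℝ ∞ φ) (hΦ0 : ∀ y, 1 < ‖y‖ → Φ y = 0) (hφ0 : ∀ y, 1 < ‖y‖ → φ y = 0)
  (hpd : ∀ i y, pd i Φ y = y i * φ y)
include hg

include hΦ hΦ0 hpd hφ0 in
-- Curl freeness replaces ∂ᵢg_k by ∂_k gᵢ; integrating by parts twice, with second derivatives
-- falling only on Φ, gives ∫ (div g) ∂_kΦ = 0. Thus g need only be C¹.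
lemma sum_integral_eq_zero {x : R3} {t : ℝ} (ht : t ≠ 0)
    (hcurl : ∀ i k, ∀ y, ‖y‖ ≤ 1 → pd i (g k) (x + t • y) = pd k (g i) (x + t • y))
    (hdiv : ∀ y, ‖y‖ ≤ 1 → ∑ i, pd i (g i) (x + t • y) = 0) (k : Fin 3) :
    ∫ y, ∑ i, pd i (g k) (x + t • y) * pd i Φ y = 0 := by
  have hΦc : HasCompactSupport Φ := HasCompactSupport.intro (isCompact_closedBall (0 : R3) 1)
    fun y hy => hΦ0 y (by simpa using hy)
  have hpd0 : ∀ i y, 1 < ‖y‖ → pd i Φ y = 0 := fun i y hy => by rw [hpd, hφ0 y hy, mul_zero]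
  set h : Fin 3 → R3 → ℝ := fun i z => g i (x + t • z) with hh
  have hsm : ∀ i, ContDiff ℝ 1 (h i) := fun i =>
    (hg i).comp (contDiff_const.add (contDiff_const_smul t))
  have hpdh : ∀ i j y, pd i (h j) y = t * pd i (g j) (x + t • y) := fun i j y =>
    pd_comp_add_smul ((hg j).differentiable one_ne_zero) x y t i
  have hs1 : ∀ j, ContDiff ℝ 1 (pd j Φ) := fun j => contDiff_pd j hΦ (by norm_num; norm_cast)
  have hcs : ∀ j, HasCompactSupport (pd j Φ) := fun j => hΦc.fderiv_apply ℝ _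
  have hint : ∀ i j l, Integrable fun y => pd i (h j) y * pd l Φ y := fun i j l =>
    (((contDiff_pd i (hsm j) (m := 0) (by norm_num)).continuous).mul
      (hs1 l).continuous).integrable_of_hasCompactSupport (hcs l).mul_left
  have swap : ∀ i, ∫ y, pd k (h i) y * pd i Φ y = ∫ y, pd i (h i) y * pd k Φ y := by
    intro i
    have e1 := integral_mul_pd_eq_neg (hsm i) (hs1 i) (hcs i) k
    have e2 := integral_mul_pd_eq_neg (hsm i) (hs1 k) (hcs k) i
    have e3 : pd k (pd i Φ) = pd i (pd k Φ) := by
      ext y; exact pd_pd_comm (hΦ.contDiffAt.of_le (by norm_cast)) k i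
    rw [e3, e2] at e1
    linarith
  have main : ∫ y, ∑ i, pd i (h k) y * pd i Φ y = 0 := by
    have c1 : ∀ y, ∑ i, pd i (h k) y * pd i Φ y = ∑ i, pd k (h i) y * pd i Φ y := fun y => by
      refine Finset.sum_congr rfl fun i _ => ?_
      rcases le_or_gt ‖y‖ 1 with hy | hy
      · rw [hpdh, hpdh, hcurl i k y hy]
      · rw [hpd0 i y hy, mul_zero, mul_zero]
    simp only [c1]
    rw [integral_finsetSum _ fun i _ => hint k i i, Finset.sum_congr rfl fun i _ => swap i,
      ← integral_finsetSum _ fun i _ => hint i i k]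
    refine integral_eq_zero_of_ae (Filter.Eventually.of_forall fun y => ?_)
    simp only [Pi.zero_apply]
    rw [← Finset.sum_mul]
    rcases le_or_gt ‖y‖ 1 with hy | hy
    · simp only [hpdh]
      rw [← Finset.mul_sum, hdiv y hy, mul_zero, zero_mul]
    · rw [hpd0 k y hy, mul_zero]
  have e : ∀ y, ∑ i, pd i (h k) y * pd i Φ y = t * ∑ i, pd i (g k) (x + t • y) * pd i Φ y :=
    fun y => by
      rw [Finset.mul_sum]
      exact Finset.sum_congr rfl fun i _ => by rw [hpdh]; ring
  simp only [e] at main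
  rw [integral_const_mul] at main
  exact (mul_eq_zero.1 main).resolve_left ht

include hgc hφ hφ0 in
lemma hasDerivAt_integral_dilation (x : R3) (t : ℝ) (k : Fin 3) :
    HasDerivAt (fun s : ℝ => ∫ y, g k (x + s • y) * φ y)
      (∫ y, fderiv ℝ (g k) (x + t • y) y * φ y) t := by
  have hφc : HasCompactSupport φ := HasCompactSupport.intro (isCompact_closedBall (0 : R3) 1)
    fun y hy => hφ0 y (by simpa using hy)
  have hfd : Continuous (fderiv ℝ (g k)) := (hg k).continuous_fderiv one_ne_zero
  obtain ⟨C, hC⟩ := hfd.bounded_above_of_compact_support ((hgc k).fderiv ℝ)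
  have hcont : ∀ s : ℝ, Continuous fun y => g k (x + s • y) * φ y := fun s =>
    ((hg k).continuous.comp (by fun_prop)).mul hφ.continuous
  have hcont' : Continuous fun y => fderiv ℝ (g k) (x + t • y) y * φ y :=
    ((hfd.comp (by fun_prop : Continuous fun y : R3 => x + t • y)).clm_apply
      continuous_id).mul hφ.continuous
  refine (hasDerivAt_integral_of_dominated_loc_of_deriv_le (s := Set.univ)
    (bound := fun y => C * ‖y‖ * ‖φ y‖)
    (F' := fun s y => fderiv ℝ (g k) (x + s • y) y * φ y) Filter.univ_mem
    (Filter.Eventually.of_forall fun s => (hcont s).aestronglyMeasurable)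
    ((hcont t).integrable_of_hasCompactSupport hφc.mul_left)
    hcont'.aestronglyMeasurable (Filter.Eventually.of_forall fun y s _ => ?_) ?_
    (Filter.Eventually.of_forall fun y s _ => ?_)).2
  · rw [norm_mul]
    gcongr
    exact (fderiv ℝ (g k) (x + s • y)).le_of_opNorm_le (hC _) y
  · exact Continuous.integrable_of_hasCompactSupport (by have := hφ.continuous; fun_prop)
      hφc.norm.mul_left
  · have h1 : HasDerivAt (fun s : ℝ => x + s • y) y s := by
      simpa using ((hasDerivAt_id s).smul_const y).const_add x
    have h2 := ((hg k).differentiable one_ne_zero (x + s • y)).hasFDerivAt.comp_hasDerivAt s h1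
    exact h2.mul_const _

include hgc hΦ hφ hΦ0 hφ0 hpd in
-- The φ-average of g_k over dilations about x has zero derivative in the dilation parameter.
lemma mean_value {x : R3} {r : ℝ} (hr : 0 < r)
    (hcurl : ∀ i k, ∀ z ∈ Metric.ball x r, pd i (g k) z = pd k (g i) z)
    (hdiv : ∀ z ∈ Metric.ball x r, ∑ i, pd i (g i) z = 0) (k : Fin 3) :
    ∫ y, g k (x + r • y) * φ y = g k x * ∫ y, φ y := by
  have hd := hasDerivAt_integral_dilation hg hgc hφ hφ0 x
  -- The slope between 0 and r is the derivative at an interior c > 0, where `sum_integral_eq_zero`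
  -- applies.
  obtain ⟨c, hc, h⟩ := exists_hasDerivAt_eq_slope (fun s : ℝ => ∫ y, g k (x + s • y) * φ y)
    (fun t => ∫ y, fderiv ℝ (g k) (x + t • y) y * φ y) hr
    (fun t _ => (hd t k).continuousAt.continuousWithinAt) (fun t _ => hd t k)
  have hmem : ∀ y : R3, ‖y‖ ≤ 1 → x + c • y ∈ Metric.ball x r := fun y hy => by
    rw [mem_ball_iff_norm, add_sub_cancel_left, norm_smul, Real.norm_of_nonneg hc.1.le]
    nlinarith [hc.1, hc.2]
  have h0 : ∫ y, fderiv ℝ (g k) (x + c • y) y * φ y = 0 := by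
    rw [← sum_integral_eq_zero hg hΦ hΦ0 hφ0 hpd hc.1.ne'
      (fun i k y hy => hcurl i k _ (hmem y hy)) (fun y hy => hdiv _ (hmem y hy)) k]
    congr 1
    ext y
    rw [fderiv_apply_eq_sum_pd, Finset.sum_mul]
    exact Finset.sum_congr rfl fun i _ => by rw [hpd]; ring
  rw [h0, eq_comm, div_eq_zero_iff] at h
  have h1 := h.resolve_right (by linarith)
  simp only [zero_smul, add_zero] at h1
  rw [integral_const_mul] at h1
  linarith

include hφ hφ0 in
lemma contDiff_integral_dilation {r : ℝ} (hr : 0 < r) (k : Fin 3) :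
    ContDiff ℝ ∞ fun x => ∫ y, g k (x + r • y) * φ y := by
  -- Substituting z = -r y makes the average a convolution with a smooth kernel.
  set ψ : R3 → ℝ := fun z => φ ((-r)⁻¹ • z) with hψ
  have hψs : ContDiff ℝ ∞ ψ := hφ.comp (contDiff_const_smul _)
  have hψc : HasCompactSupport ψ := by
    refine HasCompactSupport.intro (isCompact_closedBall (0 : R3) r) fun z hz => hφ0 _ ?_
    rw [mem_closedBall_zero_iff, not_le] at hz
    rw [norm_smul, norm_inv, norm_neg, Real.norm_of_nonneg hr.le, inv_mul_eq_div, one_lt_div hr]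
    exact hz
  have hc := hψc.contDiff_convolution_left (ContinuousLinearMap.mul ℝ ℝ) (μ := volume)
    (n := ⊤) hψs ((hg k).continuous.locallyIntegrable)
  have e : (fun x => ∫ y, g k (x + r • y) * φ y) = fun x =>
      |((-r) ^ Module.finrank ℝ R3)⁻¹| *
        convolution ψ (g k) (ContinuousLinearMap.mul ℝ ℝ) volume x := by
    ext x
    rw [convolution_def, ← smul_eq_mul, ← Measure.integral_comp_smul]
    congr 1
    ext y
    simp only [hψ, smul_smul, inv_mul_cancel₀ (neg_ne_zero.2 hr.ne'), one_smul,
      ContinuousLinearMap.mul_apply']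
    rw [neg_smul, sub_neg_eq_add, mul_comm]
  rw [e]
  exact contDiff_const.mul hc

end

/-- Divergence free and curl free fields of class `C¹` are smooth. -/
theorem contDiffAt_of_div_curl_free {G : Fin 3 → R3 → ℝ} {Ω : Set R3} (hΩ : IsOpen Ω)
    (hG : ∀ k, ContDiffOn ℝ 1 (G k) Ω)
    (hcurl : ∀ i k, ∀ z ∈ Ω, pd i (G k) z = pd k (G i) z)
    (hdiv : ∀ z ∈ Ω, ∑ i, pd i (G i) z = 0) (k : Fin 3) {x : R3} (hx : x ∈ Ω) :
    ContDiffAt ℝ ∞ (G k) x := by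
  obtain ⟨Φ, φ, hΦ, hφ, hΦ0, hφ0, hpd, hne⟩ := exists_radial_mollifier
  obtain ⟨ε, hε, hball⟩ := Metric.isOpen_iff.1 hΩ x hx
  set r := ε / 4 with hr
  have hr0 : 0 < r := by positivity
  let χ : ContDiffBump x := ⟨2 * r, 3 * r, by positivity, by linarith⟩
  set g : Fin 3 → R3 → ℝ := fun k z => χ z * G k z with hg
  have hsupp : tsupport χ ⊆ Ω := by
    rw [χ.tsupport_eq]
    exact (Metric.closedBall_subset_ball (by change 3 * r < ε; linarith)).trans hball
  have hgs : ∀ k, ContDiff ℝ 1 (g k) := fun k => by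
    rw [contDiff_iff_contDiffAt]
    intro z
    by_cases hz : z ∈ Ω
    · exact χ.contDiff.contDiffAt.mul ((hG k).contDiffAt (hΩ.mem_nhds hz))
    · have : g k =ᶠ[nhds z] fun _ => 0 := by
        filter_upwards [notMem_tsupport_iff_eventuallyEq.1 fun h => hz (hsupp h)] with w hw
        simp only [hg, hw, Pi.zero_apply, zero_mul]
      exact contDiffAt_const.congr_of_eventuallyEq this
  have hgc : ∀ k, HasCompactSupport (g k) := fun k => χ.hasCompactSupport.mul_right
  have heq : ∀ k, ∀ z ∈ Metric.ball x (2 * r), g k =ᶠ[nhds z] G k := fun k z hz => by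
    filter_upwards [Metric.isOpen_ball.mem_nhds hz] with w hw
    simp only [hg]
    rw [χ.one_of_mem_closedBall (Metric.ball_subset_closedBall hw), one_mul]
  have hsub : Metric.ball x (2 * r) ⊆ Ω :=
    (Metric.ball_subset_ball (by linarith)).trans hball
  have key : ∀ w ∈ Metric.ball x r, G k w = (∫ y, g k (w + r • y) * φ y) / ∫ y, φ y := by
    intro w hw
    have hs : Metric.ball w r ⊆ Metric.ball x (2 * r) :=
      Metric.ball_subset_ball' (by rw [Metric.mem_ball] at hw; linarith)
    rw [mean_value hgs hgc hΦ hφ hΦ0 hφ0 hpd hr0 (fun i k z hz => ?_) (fun z hz => ?_) k,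
      mul_div_cancel_right₀ _ hne, (heq k w (hs (Metric.mem_ball_self hr0))).eq_of_nhds]
    · rw [pd_congr (heq k z (hs hz)), pd_congr (heq i z (hs hz)), hcurl i k z (hsub (hs hz))]
    · rw [← hdiv z (hsub (hs hz))]
      exact Finset.sum_congr rfl fun i _ => pd_congr (heq i z (hs hz)) i
  have hsm := (contDiff_integral_dilation hgs hφ hφ0 hr0 k).div_const (∫ y, φ y)
  refine hsm.contDiffAt.congr_of_eventuallyEq ?_
  filter_upwards [Metric.ball_mem_nhds x hr0] with w hw using key w hw

end SolidHarmonic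

namespace SolidHarmonic
open scoped ContDiff
open Ambigenic (R3)

/-! ### Classification of homogeneous harmonic functions -/

lemma pd_add {u v : R3 → ℝ} {x : R3} (hu : DifferentiableAt ℝ u x) (hv : DifferentiableAt ℝ v x)
    (j : Fin 3) : pd j (u + v) x = pd j u x + pd j v x := by
  simp [pd, fderiv_add hu hv]

lemma pd_sub {u v : R3 → ℝ} {x : R3} (hu : DifferentiableAt ℝ u x) (hv : DifferentiableAt ℝ v x)
    (j : Fin 3) : pd j (u - v) x = pd j u x - pd j v x := by
  simp [pd, fderiv_sub hu hv]

lemma pd_neg (u : R3 → ℝ) (x : R3) (j : Fin 3) : pd j (-u) x = -pd j u x := by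
  simp [pd, fderiv_neg]

lemma pd_const_smul {u : R3 → ℝ} {x : R3} (hu : DifferentiableAt ℝ u x) (c : ℝ) (j : Fin 3) :
    pd j (c • u) x = c * pd j u x := by
  simp [pd, fderiv_const_smul hu]

lemma pd_ev (p : Poly) (j : Fin 3) : pd j (ev p) = ev (MvPolynomial.pderiv j p) := by
  ext x; exact fderiv_ev p j x

lemma pd_zero (j : Fin 3) : pd j 0 = 0 := by
  ext x; simp [pd]

lemma contDiff_pd_infty {u : R3 → ℝ} (j : Fin 3) (hu : ContDiff ℝ ∞ u) : ContDiff ℝ ∞ (pd j u) :=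
  contDiff_pd j hu (by simp)

lemma _root_.ContDiff.differentiable_infty {u : R3 → ℝ} (hu : ContDiff ℝ ∞ u) : Differentiable ℝ u :=
  hu.differentiable (by simp)

lemma pd_comm {u : R3 → ℝ} (hu : ContDiff ℝ ∞ u) (i j : Fin 3) :
    pd i (pd j u) = pd j (pd i u) := by
  ext x
  exact pd_pd_comm (hu.contDiffAt.of_le (by norm_cast)) i j

/-- `u` is positively homogeneous of degree `n` on `ℝ³`. -/
def IsHom (n : ℕ) (u : R3 → ℝ) : Prop := ∀ t : ℝ, 0 < t → ∀ x, u (t • x) = t ^ n * u x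

lemma pd_smul_arg {u : R3 → ℝ} (hu : Differentiable ℝ u) {t c : ℝ} (ht : t ≠ 0)
    (h : ∀ x, u (t • x) = c * u x) (j : Fin 3) (x : R3) :
    pd j u (t • x) = c / t * pd j u x := by
  have h1 := pd_comp_add_smul hu 0 x t j
  simp only [zero_add] at h1
  have h2 : (fun z => u (t • z)) = c • u := by ext z; simp [h]
  rw [h2, pd_const_smul (hu x)] at h1
  field_simp
  linarith

lemma IsHom.pd {n : ℕ} {u : R3 → ℝ} (hu : Differentiable ℝ u) (h : IsHom (n + 1) u) (j : Fin 3) :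
    IsHom n (pd j u) := fun t ht x => by
  rw [pd_smul_arg hu ht.ne' (h t ht), pow_succ, mul_div_assoc, div_self ht.ne', mul_one]

lemma IsHom.euler {n : ℕ} {u : R3 → ℝ} (hu : Differentiable ℝ u) (h : IsHom n u) (x : R3) :
    ∑ i, x i * SolidHarmonic.pd i u x = n * u x := by
  rw [← fderiv_apply_eq_sum_pd]
  have h1 : HasDerivAt (fun t : ℝ => t • x) x 1 := by
    simpa using (hasDerivAt_id (1 : ℝ)).smul_const x
  have h2 : HasDerivAt (fun t : ℝ => u (t • x)) (fderiv ℝ u x x) 1 := by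
    have h3 : HasFDerivAt u (fderiv ℝ u x) ((1 : ℝ) • x) := by
      rw [one_smul]; exact (hu x).hasFDerivAt
    exact h3.comp_hasDerivAt 1 h1
  have h4 : HasDerivAt (fun t : ℝ => t ^ n * u x) (n * 1 ^ (n - 1) * u x) 1 :=
    (hasDerivAt_pow n 1).mul_const _
  have h5 : (fun t : ℝ => u (t • x)) =ᶠ[nhds 1] fun t => t ^ n * u x := by
    filter_upwards [lt_mem_nhds zero_lt_one] with t ht using h t ht x
  have := h2.unique (h4.congr_of_eventuallyEq h5)
  simpa using this

lemma IsHom.apply_zero {n : ℕ} {u : R3 → ℝ} (h : IsHom (n + 1) u) : u 0 = 0 := by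
  have h1 := h 2 two_pos 0
  rw [smul_zero] at h1
  have h2 : (1 : ℝ) < 2 ^ (n + 1) := one_lt_pow₀ one_lt_two (Nat.succ_ne_zero n)
  nlinarith

lemma eq_const_of_pd_eq_zero {u : R3 → ℝ} (hu : Differentiable ℝ u) (h : ∀ j, pd j u = 0)
    (x : R3) : u x = u 0 := by
  refine is_const_of_fderiv_eq_zero (𝕜 := ℝ) hu (fun y => ?_) x 0
  ext v
  rw [fderiv_apply_eq_sum_pd]
  simp [h]

lemma IsHom.eq_const {u : R3 → ℝ} (hu : Continuous u) (h : IsHom 0 u) (x : R3) : u x = u 0 := by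
  have h1 : Filter.Tendsto (fun t : ℝ => u (t • x)) (nhdsWithin 0 (Set.Ioi 0)) (nhds (u 0)) := by
    have : ContinuousAt (fun t : ℝ => u (t • x)) 0 := by fun_prop
    have h2 := this.tendsto
    simp only [zero_smul] at h2
    exact h2.mono_left nhdsWithin_le_nhds
  have h3 : Filter.Tendsto (fun t : ℝ => u (t • x)) (nhdsWithin 0 (Set.Ioi 0)) (nhds (u x)) := by
    refine tendsto_const_nhds.congr' ?_
    filter_upwards [self_mem_nhdsWithin] with t ht
    rw [h t ht, pow_zero, one_mul]
  exact tendsto_nhds_unique h3 h1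

/-- The smooth harmonic functions on `ℝ³` that are homogeneous of degree `n`. -/
def harmonicHom (n : ℕ) : Submodule ℝ (R3 → ℝ) where
  carrier := {u | ContDiff ℝ ∞ u ∧ IsHom n u ∧ ∀ x, ∑ i, pd i (pd i u) x = 0}
  zero_mem' := ⟨contDiff_const, fun t _ x => by simp, fun x => by simp [pd_zero]⟩
  add_mem' := by
    rintro u v ⟨hu, hu1, hu2⟩ ⟨hv, hv1, hv2⟩
    refine ⟨hu.add hv, fun t ht x => by simp [hu1 t ht x, hv1 t ht x, mul_add], fun x => ?_⟩
    have h : ∀ i, pd i (u + v) = pd i u + pd i v := fun i => by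
      ext y
      exact pd_add (hu.differentiable_infty y) (hv.differentiable_infty y) i
    simp only [h]
    have h2 : ∀ i, pd i (pd i u + pd i v) x = pd i (pd i u) x + pd i (pd i v) x := fun i =>
      pd_add ((contDiff_pd_infty i hu).differentiable_infty x)
        ((contDiff_pd_infty i hv).differentiable_infty x) i
    simp only [h2, Finset.sum_add_distrib, hu2, hv2, add_zero]
  smul_mem' := by
    rintro c u ⟨hu, hu1, hu2⟩
    refine ⟨hu.const_smul c, fun t ht x => by simp [hu1 t ht x]; ring, fun x => ?_⟩
    have h : ∀ i, pd i (c • u) = c • pd i u := fun i => by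
      ext y
      exact pd_const_smul (hu.differentiable_infty y) c i
    simp only [h]
    have h2 : ∀ i, pd i (c • pd i u) x = c * pd i (pd i u) x := fun i =>
      pd_const_smul ((contDiff_pd_infty i hu).differentiable_infty x) c i
    simp only [h2, ← Finset.mul_sum, hu2, mul_zero]

lemma ev_mem_harmonicHom {n : ℕ} {p : Poly} (hp : p.IsHomogeneous n) (hl : lap p = 0) :
    ev p ∈ harmonicHom n := by
  refine ⟨contDiff_ev p, fun t _ x => ev_smul hp t x, fun x => ?_⟩
  simp only [pd_ev, Fin.sum_univ_three]
  have := congrArg (fun q => ev q x) hl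
  simpa only [lap, ev_add, ev_zero, Pi.add_apply, Pi.zero_apply] using this

lemma pd_mem_harmonicHom {n : ℕ} {u : R3 → ℝ} (hu : u ∈ harmonicHom (n + 1)) (j : Fin 3) :
    pd j u ∈ harmonicHom n := by
  obtain ⟨h1, h2, h3⟩ := hu
  refine ⟨contDiff_pd_infty j h1, h2.pd h1.differentiable_infty j, fun x => ?_⟩
  have h4 : ∀ i, pd i (pd i (pd j u)) = pd j (pd i (pd i u)) := fun i => by
    rw [pd_comm h1 i j, pd_comm (contDiff_pd_infty i h1) i j]
  have h5 : ∀ i, Differentiable ℝ (pd i (pd i u)) := fun i =>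
    (contDiff_pd_infty i (contDiff_pd_infty i h1)).differentiable_infty
  have h6 : pd 0 (pd 0 u) + pd 1 (pd 1 u) + pd 2 (pd 2 u) = 0 := by
    ext y; simpa [Fin.sum_univ_three] using h3 y
  have h7 := congrFun (congrArg (pd j) h6) x
  rw [pd_add ((h5 0).add (h5 1) x) (h5 2 x), pd_add (h5 0 x) (h5 1 x), pd_zero] at h7
  simpa [h4, Fin.sum_univ_three] using h7

/-- The span of the solid harmonics of degree `n`. -/
def solidSpan (n : ℕ) : Submodule ℝ (R3 → ℝ) :=
  Submodule.span ℝ (Set.range (fun m => ev (polyU n m)) ∪ Set.range (fun m => ev (polyV n m)))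

lemma polyU_mem_solidSpan (n m : ℕ) : ev (polyU n m) ∈ solidSpan n :=
  Submodule.subset_span (Or.inl ⟨m, rfl⟩)

lemma polyV_mem_solidSpan (n m : ℕ) : ev (polyV n m) ∈ solidSpan n :=
  Submodule.subset_span (Or.inr ⟨m, rfl⟩)

lemma solidSpan_le_harmonicHom (n : ℕ) : solidSpan n ≤ harmonicHom n := by
  refine Submodule.span_le.2 ?_
  rintro _ (⟨m, rfl⟩ | ⟨m, rfl⟩)
  · exact ev_mem_harmonicHom (isHomogeneous_polyU n m) (lap_polyU n m)
  · exact ev_mem_harmonicHom (isHomogeneous_polyV n m) (lap_polyV n m)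

lemma cos_mem_solidSpan (n : ℕ) : ev (cosSin n).1 ∈ solidSpan n := by
  have h := (solidSpan n).smul_mem (sectorialCoeff n)⁻¹ (polyU_mem_solidSpan n n)
  rwa [polyU_self, ev_C_mul, smul_smul, inv_mul_cancel₀ (sectorialCoeff_ne_zero n), one_smul] at h

lemma sin_mem_solidSpan (n : ℕ) : ev (cosSin n).2 ∈ solidSpan n := by
  have h := (solidSpan n).smul_mem (sectorialCoeff n)⁻¹ (polyV_mem_solidSpan n n)
  rwa [polyV_self, ev_C_mul, smul_smul, inv_mul_cancel₀ (sectorialCoeff_ne_zero n), one_smul] at h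

/-- The lowering factors n+1+m never vanish. -/
lemma exists_pd_zero_eq {n : ℕ} {u : R3 → ℝ} (hu : u ∈ solidSpan n) :
    ∃ v ∈ solidSpan (n + 1), pd 0 v = u := by
  induction hu using Submodule.span_induction with
  | mem u h =>
    have key : ∀ (m : ℕ) (p q : Poly), MvPolynomial.pderiv 0 q = MvPolynomial.C ((n : ℝ) + 1 + m) * p →
        ev q ∈ solidSpan (n + 1) → ∃ v ∈ solidSpan (n + 1), pd 0 v = ev p := by
      intro m p q h hq
      have hne : (n : ℝ) + 1 + m ≠ 0 := by positivity
      refine ⟨_, (solidSpan (n + 1)).smul_mem ((n : ℝ) + 1 + m)⁻¹ hq, ?_⟩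
      rw [← ev_C_mul, pd_ev, MvPolynomial.pderiv_C_mul, h, ev_C_mul, ev_C_mul, smul_smul,
        inv_mul_cancel₀ hne, one_smul]
    rcases h with ⟨m, rfl⟩ | ⟨m, rfl⟩
    · exact key m _ _ (pderiv_zero_polyU n m) (polyU_mem_solidSpan _ _)
    · exact key m _ _ (pderiv_zero_polyV n m) (polyV_mem_solidSpan _ _)
  | zero => exact ⟨0, Submodule.zero_mem _, pd_zero 0⟩
  | add u v _ _ hu hv =>
    obtain ⟨u', hu', rfl⟩ := hu
    obtain ⟨v', hv', rfl⟩ := hv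
    refine ⟨u' + v', Submodule.add_mem _ hu' hv', ?_⟩
    ext x
    exact pd_add ((solidSpan_le_harmonicHom _ hu').1.differentiable_infty x)
      ((solidSpan_le_harmonicHom _ hv').1.differentiable_infty x) 0
  | smul c u _ hu =>
    obtain ⟨u', hu', rfl⟩ := hu
    refine ⟨c • u', Submodule.smul_mem _ c hu', ?_⟩
    ext x
    exact pd_const_smul ((solidSpan_le_harmonicHom _ hu').1.differentiable_infty x) c 0

/-- By induction ∂₁u is planar, and subtracting a planar polynomial with the same ∂₁ leaves w
depending on x₂ only. Harmonicity makes ∂₂w constant. -/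
lemma exists_planar {n : ℕ} {u : R3 → ℝ} (hu : u ∈ harmonicHom n) (h0 : pd 0 u = 0) :
    ∃ a b : ℝ, u = ev (MvPolynomial.C a * (cosSin n).1 + MvPolynomial.C b * (cosSin n).2) := by
  induction n generalizing u with
  | zero =>
    refine ⟨u 0, 0, ?_⟩
    ext x
    rw [hu.2.1.eq_const hu.1.continuous x]
    simp [ev, cosSin]
  | succ n ih =>
    have h01 : pd 0 (pd 1 u) = 0 := by rw [pd_comm hu.1, h0, pd_zero]
    obtain ⟨a, b, hab⟩ := ih (pd_mem_harmonicHom hu 1) h01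
    set p := MvPolynomial.C (a / (n + 1)) * (cosSin (n + 1)).1 +
      MvPolynomial.C (b / (n + 1)) * (cosSin (n + 1)).2 with hp
    have hn : (n : ℝ) + 1 ≠ 0 := by positivity
    have hpm : ev p ∈ harmonicHom (n + 1) := by
      rw [hp, ev_add, ev_C_mul, ev_C_mul]
      exact Submodule.add_mem _
        (Submodule.smul_mem _ _ (solidSpan_le_harmonicHom _ (cos_mem_solidSpan _)))
        (Submodule.smul_mem _ _ (solidSpan_le_harmonicHom _ (sin_mem_solidSpan _)))
    set w := u - ev p with hw
    have hwm : w ∈ harmonicHom (n + 1) := Submodule.sub_mem _ hu hpm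
    have hpd : ∀ j, pd j w = pd j u - pd j (ev p) := fun j => by
      ext x
      exact pd_sub (hu.1.differentiable_infty x) (hpm.1.differentiable_infty x) j
    obtain ⟨⟨d1, d2⟩, -, -⟩ := pderiv_cosSin_succ n
    obtain ⟨z1, z2⟩ := pderiv_zero_cosSin (n + 1)
    have hw0 : pd 0 w = 0 := by
      rw [hpd, h0, pd_ev, hp, map_add, MvPolynomial.pderiv_C_mul, MvPolynomial.pderiv_C_mul, z1, z2]
      simp [ev_zero]
    have hw1 : pd 1 w = 0 := by
      rw [hpd, hab, pd_ev, hp, map_add, MvPolynomial.pderiv_C_mul, MvPolynomial.pderiv_C_mul,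
        d1, d2, ← mul_assoc, ← mul_assoc, ← MvPolynomial.C_mul, ← MvPolynomial.C_mul,
        div_mul_cancel₀ _ hn, div_mul_cancel₀ _ hn, sub_self]
    have hw22 : pd 2 (pd 2 w) = 0 := by
      ext x
      have := hwm.2.2 x
      simpa [Fin.sum_univ_three, hw0, hw1, pd_zero] using this
    have hw2 : ∀ x, pd 2 w x = pd 2 w 0 := by
      refine eq_const_of_pd_eq_zero (contDiff_pd_infty 2 hwm.1).differentiable_infty fun j => ?_
      fin_cases j
      · exact (pd_comm hwm.1 0 2).trans (by rw [hw0, pd_zero])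
      · exact (pd_comm hwm.1 1 2).trans (by rw [hw1, pd_zero])
      · exact hw22
    have hu' : u = ev p + w := by rw [hw]; abel
    -- The constant ∂₂w is homogeneous of degree n: it survives for n = 0, giving a multiple of x₂,
    -- and vanishes otherwise.
    rcases n with _ | n
    · set c := pd 2 w 0 with hc
      have hX2 : (cosSin 1).2 = MvPolynomial.X 2 := by simp [cosSin]
      have hv : w = ev (MvPolynomial.C c * (cosSin 1).2) := by
        have hm : ev (MvPolynomial.C c * (cosSin 1).2) ∈ harmonicHom 1 := by
          rw [ev_C_mul]
          exact Submodule.smul_mem _ _ (solidSpan_le_harmonicHom _ (sin_mem_solidSpan _))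
        have hm2 := Submodule.sub_mem _ hwm hm
        have h1 := eq_const_of_pd_eq_zero hm2.1.differentiable_infty fun j => by
          ext x
          rw [pd_sub (hwm.1.differentiable_infty x) (hm.1.differentiable_infty x), pd_ev,
            MvPolynomial.pderiv_C_mul, hX2]
          fin_cases j
          · simp [hw0, ev_zero]
          · simp [hw1, ev_zero]
          · simp [hw2, ev]
        ext x
        have h2 := h1 x
        rw [hm2.2.1.apply_zero] at h2
        simpa [sub_eq_zero] using h2
      refine ⟨a / ((0 : ℕ) + 1), b / ((0 : ℕ) + 1) + c, ?_⟩
      rw [hu', hv, ← ev_add, hp, MvPolynomial.C_add]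
      congr 1
      ring
    · have hc := ((hwm.2.1.pd hwm.1.differentiable_infty) 2).apply_zero
      have hw3 : w = 0 := by
        ext x
        rw [eq_const_of_pd_eq_zero hwm.1.differentiable_infty (fun j => ?_) x,
          hwm.2.1.apply_zero, Pi.zero_apply]
        fin_cases j
        · exact hw0
        · exact hw1
        · ext x; exact (hw2 x).trans hc
      exact ⟨_, _, by rw [hu', hw3, add_zero]⟩

/-- Every homogeneous harmonic function is a combination of the solid harmonics. -/
theorem harmonicHom_le_solidSpan (n : ℕ) : harmonicHom n ≤ solidSpan n := by
  have planar : ∀ (n : ℕ) (u : R3 → ℝ), u ∈ harmonicHom n → pd 0 u = 0 → u ∈ solidSpan n := by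
    intro n u hu h0
    obtain ⟨a, b, rfl⟩ := exists_planar hu h0
    rw [ev_add, ev_C_mul, ev_C_mul]
    exact Submodule.add_mem _ (Submodule.smul_mem _ _ (cos_mem_solidSpan n))
      (Submodule.smul_mem _ _ (sin_mem_solidSpan n))
  induction n with
  | zero =>
    intro u hu
    refine planar 0 u hu ?_
    have : u = fun _ => u 0 := funext fun x => hu.2.1.eq_const hu.1.continuous x
    rw [this]
    ext x
    simp [pd]
  | succ n ih =>
    intro u hu
    -- Subtracting v, with ∂₀v = ∂₀u, reduces to the planar case.
    obtain ⟨v, hv, hvu⟩ := exists_pd_zero_eq (ih (pd_mem_harmonicHom hu 0))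
    have hv' := solidSpan_le_harmonicHom _ hv
    have h : u - v ∈ solidSpan (n + 1) := by
      refine planar _ _ (Submodule.sub_mem _ hu hv') ?_
      ext x
      rw [pd_sub (hu.1.differentiable_infty x) (hv'.1.differentiable_infty x), hvu]
      simp
    have := Submodule.add_mem _ h hv
    rwa [sub_add_cancel] at this

/-! ### Potentials of homogeneous fields -/

/-- The potential of a homogeneous curl free field. -/
def potential (n : ℕ) (G : Fin 3 → R3 → ℝ) (x : R3) : ℝ := (∑ i, x i * G i x) / (n + 1)

lemma contDiff_potential (n : ℕ) {G : Fin 3 → R3 → ℝ} (hG : ∀ i, ContDiff ℝ ∞ (G i)) :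
    ContDiff ℝ ∞ (potential n G) := by
  refine ContDiff.div_const (ContDiff.sum fun i _ => ContDiff.mul ?_ (hG i)) _
  exact (EuclideanSpace.proj i : R3 →L[ℝ] ℝ).contDiff

lemma isHom_potential {n : ℕ} {G : Fin 3 → R3 → ℝ} (hG : ∀ i, IsHom n (G i)) :
    IsHom (n + 1) (potential n G) := fun t ht x => by
  simp only [potential]
  rw [← mul_div_assoc, Finset.mul_sum]
  congr 1
  refine Finset.sum_congr rfl fun i _ => ?_
  rw [hG i t ht, PiLp.smul_apply, smul_eq_mul]
  ring

/-- By curl freeness and Euler, ∂ⱼ Σ xᵢGᵢ = Gⱼ + Σ xᵢ∂ᵢGⱼ = (n+1)Gⱼ. -/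
lemma pd_potential {n : ℕ} {G : Fin 3 → R3 → ℝ} (hG : ∀ i, Differentiable ℝ (G i))
    (hh : ∀ i, IsHom n (G i)) (hc : ∀ i j, pd i (G j) = pd j (G i)) (j : Fin 3) :
    pd j (potential n G) = G j := by
  ext x
  have hx : ∀ i, HasFDerivAt (fun y : R3 => y i) (EuclideanSpace.proj i : R3 →L[ℝ] ℝ) x :=
    fun i => (EuclideanSpace.proj i : R3 →L[ℝ] ℝ).hasFDerivAt
  have h1 : HasFDerivAt (fun y : R3 => ∑ i, y i * G i y) _ x :=
    HasFDerivAt.fun_sum fun i (_ : i ∈ Finset.univ) => (hx i).mul (hG i x).hasFDerivAt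
  have h2 : HasFDerivAt (potential n G) _ x := h1.mul_const ((n : ℝ) + 1)⁻¹
  have hn : (n : ℝ) + 1 ≠ 0 := by positivity
  have he := (hh j).euler (hG j) x
  rw [pd, h2.fderiv]
  have e : ∀ i, fderiv ℝ (G i) x (EuclideanSpace.single j 1) = pd i (G j) x := fun i => by
    rw [← hc]; rfl
  simp only [smul_apply, sum_apply, add_apply, e, smul_eq_mul, PiLp.proj_apply,
    Finset.sum_add_distrib, he]
  have e2 : ∑ i, G i x * (EuclideanSpace.single j (1 : ℝ) : R3) i = G j x := by
    simp
  rw [e2]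
  field_simp

/-- A harmonic pair which is curl free in the plane is the planar gradient of a harmonic
function. -/
lemma exists_planar_potential {n : ℕ} {p q : R3 → ℝ} (hp : p ∈ harmonicHom (n + 1))
    (hq : q ∈ harmonicHom (n + 1)) (hpq : pd 1 q = pd 2 p) :
    ∃ v ∈ solidSpan (n + 2), pd 1 v = p ∧ pd 2 v = q := by
  have dp : ∀ j, Differentiable ℝ (pd j p) := fun j =>
    (contDiff_pd_infty j hp.1).differentiable_infty
  have dq : ∀ j, Differentiable ℝ (pd j q) := fun j =>
    (contDiff_pd_infty j hq.1).differentiable_infty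
  -- G is the gradient that s = ∂₀v must have, its first entry being forced by Δv = 0. It is curl
  -- free because p and q are harmonic; integrating G gives s, and integrating (s, p, q) gives v.
  set G : Fin 3 → R3 → ℝ := ![-(pd 1 p + pd 2 q), pd 0 p, pd 0 q] with hG
  have hGs : ∀ i, ContDiff ℝ ∞ (G i) := fun i => by
    fin_cases i
    · exact ((contDiff_pd_infty 1 hp.1).add (contDiff_pd_infty 2 hq.1)).neg
    · exact contDiff_pd_infty 0 hp.1
    · exact contDiff_pd_infty 0 hq.1
  have hGh : ∀ i, IsHom n (G i) := fun i => by
    fin_cases i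
    · exact (Submodule.neg_mem _ (Submodule.add_mem _ (pd_mem_harmonicHom hp 1)
        (pd_mem_harmonicHom hq 2))).2.1
    · exact (pd_mem_harmonicHom hp 0).2.1
    · exact (pd_mem_harmonicHom hq 0).2.1
  have hpd0 : ∀ j, pd j (G 0) = -(pd j (pd 1 p) + pd j (pd 2 q)) := fun j => by
    ext x
    simp only [hG, Matrix.cons_val_zero]
    rw [pd_neg, pd_add (dp 1 x) (dq 2 x)]
    rfl
  have c01 : pd 0 (G 1) = pd 1 (G 0) := by
    rw [hpd0, pd_comm hq.1 1 2, hpq]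
    ext x
    have := hp.2.2 x
    rw [Fin.sum_univ_three] at this
    simp only [hG, Matrix.cons_val_one, Matrix.cons_val_zero, Pi.neg_apply, Pi.add_apply]
    linarith
  have c02 : pd 0 (G 2) = pd 2 (G 0) := by
    rw [hpd0, pd_comm hp.1 2 1, ← hpq]
    ext x
    have := hq.2.2 x
    rw [Fin.sum_univ_three] at this
    change pd 0 (pd 0 q) x = -(pd 1 (pd 1 q) x + pd 2 (pd 2 q) x)
    linarith
  have c12 : pd 1 (G 2) = pd 2 (G 1) := by
    change pd 1 (pd 0 q) = pd 2 (pd 0 p)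
    rw [pd_comm hq.1 1 0, hpq, pd_comm hp.1 0 2]
  have curl : ∀ {H : Fin 3 → R3 → ℝ}, pd 0 (H 1) = pd 1 (H 0) → pd 0 (H 2) = pd 2 (H 0) →
      pd 1 (H 2) = pd 2 (H 1) → ∀ i j, pd i (H j) = pd j (H i) := by
    intro H h1 h2 h3 i j
    fin_cases i <;> fin_cases j <;>
      first | rfl | exact h1 | exact h2 | exact h3 | exact h1.symm | exact h2.symm | exact h3.symm
  have hs := pd_potential (fun i => (hGs i).differentiable_infty) hGh (curl c01 c02 c12)
  set s := potential n G with hs_def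
  set H : Fin 3 → R3 → ℝ := ![s, p, q] with hH
  have hHs : ∀ i, ContDiff ℝ ∞ (H i) := fun i => by
    fin_cases i
    · exact contDiff_potential n hGs
    · exact hp.1
    · exact hq.1
  have hHh : ∀ i, IsHom (n + 1) (H i) := fun i => by
    fin_cases i
    · exact isHom_potential hGh
    · exact hp.2.1
    · exact hq.2.1
  have hv := pd_potential (fun i => (hHs i).differentiable_infty) hHh
    (curl (hs 1).symm (hs 2).symm hpq)
  refine ⟨potential (n + 1) H, harmonicHom_le_solidSpan _ ⟨contDiff_potential _ hHs,
    isHom_potential hHh, fun x => ?_⟩, hv 1, hv 2⟩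
  rw [Fin.sum_univ_three, hv, hv, hv]
  change pd 0 s x + pd 1 p x + pd 2 q x = 0
  rw [hs]
  simp [hG]

/-! ### Homogeneous functions on the unit ball -/

/-- The extension to `ℝ³` of a function on the unit ball which is homogeneous of degree `n`. -/
def extendHom (n : ℕ) (f : R3 → ℝ) (x : R3) : ℝ := (1 + ‖x‖) ^ n * f ((1 + ‖x‖)⁻¹ • x)

section
variable {n : ℕ} {f : R3 → ℝ}
  (hf : ∀ t : ℝ, 0 < t → ∀ x, ‖x‖ < 1 → ‖t • x‖ < 1 → f (t • x) = t ^ n * f x)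
include hf

/-- Any scale s carrying x into the ball gives the same value, which allows s to be chosen to suit
each purpose. -/
lemma extendHom_eq {s : ℝ} (hs : 0 < s) {x : R3} (hx : s * ‖x‖ < 1) :
    extendHom n f x = (s ^ n)⁻¹ * f (s • x) := by
  have h1 : 0 < 1 + ‖x‖ := by positivity
  have h2 := hf ((1 + ‖x‖)⁻¹ * s⁻¹) (by positivity) (s • x)
    (by rwa [norm_smul, Real.norm_of_nonneg hs.le]) (by
      rw [smul_smul, mul_assoc, inv_mul_cancel₀ hs.ne', mul_one, norm_smul,
        Real.norm_of_nonneg (by positivity), inv_mul_lt_one₀ h1]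
      linarith)
  rw [smul_smul, mul_assoc, inv_mul_cancel₀ hs.ne', mul_one] at h2
  rw [extendHom, h2]
  rw [mul_pow, inv_pow, inv_pow]
  field_simp

lemma extendHom_eq_self {x : R3} (hx : ‖x‖ < 1) : extendHom n f x = f x := by
  have := extendHom_eq hf one_pos (x := x) (by simpa using hx)
  simpa using this

lemma isHom_extendHom : IsHom n (extendHom n f) := fun t ht x => by
  have h1 : 0 < 1 + ‖x‖ := by positivity
  have h2 : 0 < 1 + ‖t • x‖ := by positivity
  have key : 0 < (1 + ‖t • x‖)⁻¹ := by positivity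
  rw [extendHom_eq hf key (x := t • x) (by rw [inv_mul_lt_one₀ h2]; linarith),
    extendHom_eq hf (s := (1 + ‖t • x‖)⁻¹ * t) (by positivity) (x := x) (by
      rw [mul_assoc, inv_mul_lt_one₀ h2, norm_smul, Real.norm_of_nonneg ht.le]; linarith),
    smul_smul, mul_pow]
  field_simp

lemma contDiff_extendHom (hs : ∀ x, ‖x‖ < 1 → ContDiffAt ℝ ∞ f x) :
    ContDiff ℝ ∞ (extendHom n f) := by
  rw [contDiff_iff_contDiffAt]
  intro x
  -- A scale fixed on a neighbourhood of x avoids differentiating the norm at the origin.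
  set s := (2 + ‖x‖)⁻¹ with hs_def
  have hpos : 0 < s := by positivity
  have hlt : ∀ y : R3, ‖y‖ < ‖x‖ + 1 → s * ‖y‖ < 1 := fun y hy => by
    rw [hs_def, inv_mul_lt_one₀ (by positivity)]; linarith
  have h1 : extendHom n f =ᶠ[nhds x] fun y => (s ^ n)⁻¹ * f (s • y) := by
    filter_upwards [(continuous_norm.tendsto x).eventually (gt_mem_nhds (by linarith :
      ‖x‖ < ‖x‖ + 1))] with y hy using extendHom_eq hf hpos (hlt y hy)
  refine ContDiffAt.congr_of_eventuallyEq ?_ h1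
  refine contDiffAt_const.mul (ContDiffAt.comp x (hs _ ?_) (contDiff_const_smul s).contDiffAt)
  rw [norm_smul, Real.norm_of_nonneg hpos.le]
  exact hlt x (by linarith)

lemma extendHom_eventuallyEq {x : R3} (hx : ‖x‖ < 1) : extendHom n f =ᶠ[nhds x] f := by
  filter_upwards [(continuous_norm.tendsto x).eventually (gt_mem_nhds hx)] with y hy
  exact extendHom_eq_self hf hy

lemma pd_extendHom_smul (hs : ∀ x, ‖x‖ < 1 → ContDiffAt ℝ ∞ f x) {t : ℝ} (ht : 0 < t)
    (j : Fin 3) (x : R3) : pd j (extendHom n f) (t • x) = t ^ n / t * pd j (extendHom n f) x :=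
  pd_smul_arg (contDiff_extendHom hf hs).differentiable_infty ht.ne' (isHom_extendHom hf t ht) j x

/-- Second derivatives scale by tⁿ/t/t ≠ 0, so the Laplacian vanishes at x because it does at t • x
in the ball. Division by t avoids truncated exponents for n < 2. -/
lemma extendHom_mem_harmonicHom (hs : ∀ x, ‖x‖ < 1 → ContDiffAt ℝ ∞ f x)
    (hl : ∀ x, ‖x‖ < 1 → ∑ i, pd i (pd i f) x = 0) : extendHom n f ∈ harmonicHom n := by
  have hsm := contDiff_extendHom hf hs
  refine ⟨hsm, isHom_extendHom hf, fun x => ?_⟩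
  have h1 : 0 < 1 + ‖x‖ := by positivity
  set t := (1 + ‖x‖)⁻¹ with ht_def
  have ht : 0 < t := by positivity
  have hlt : ‖t • x‖ < 1 := by
    rw [norm_smul, Real.norm_of_nonneg ht.le, ht_def, inv_mul_lt_one₀ h1]; linarith
  have h2 : ∀ i, pd i (pd i (extendHom n f)) (t • x) =
      t ^ n / t / t * pd i (pd i (extendHom n f)) x := fun i =>
    pd_smul_arg (contDiff_pd_infty i hsm).differentiable_infty ht.ne'
      (pd_extendHom_smul hf hs ht i) i x
  have h3 : ∀ i, pd i (extendHom n f) =ᶠ[nhds (t • x)] pd i f := fun i => by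
    filter_upwards [(extendHom_eventuallyEq hf hlt).eventually_nhds] with y hy
    exact pd_congr hy i
  have h4 := hl _ hlt
  rw [Finset.sum_congr rfl fun i _ => (pd_congr (h3 i) i).symm,
    Finset.sum_congr rfl fun i _ => h2 i, ← Finset.mul_sum] at h4
  exact (mul_eq_zero.1 h4).resolve_left (by positivity)

end

end SolidHarmonic

namespace SolidHarmonic
open scoped ContDiff
open MvPolynomial (C)
open MeasureTheory
open Ambigenic (R3 unitBall conjMap ambigenic monogenic homogeneousAmbigenic scalarProduct family
  ballVolume partialD e₁ e₂ Dbar)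

/-! ### Quaternion valued functions and their components -/

/-- The real part as a continuous linear functional. -/
def coordRe : ℍ[ℝ] →L[ℝ] ℝ := ⟨QuaternionAlgebra.reₗ _ _ _, Quaternion.continuous_re⟩

/-- The `e₁` component as a continuous linear functional. -/
def coordI : ℍ[ℝ] →L[ℝ] ℝ := ⟨QuaternionAlgebra.imIₗ _ _ _, Quaternion.continuous_imI⟩

/-- The `e₂` component as a continuous linear functional. -/
def coordJ : ℍ[ℝ] →L[ℝ] ℝ := ⟨QuaternionAlgebra.imJₗ _ _ _, Quaternion.continuous_imJ⟩

/-- The `e₃` component as a continuous linear functional. -/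
def coordK : ℍ[ℝ] →L[ℝ] ℝ := ⟨QuaternionAlgebra.imKₗ _ _ _, Quaternion.continuous_imK⟩

lemma coordK_apply (q : ℍ[ℝ]) : coordK q = q.imK := rfl

/-- The quaternion `a + b e₁ + c e₂`. -/
def paravector (a b c : ℝ) : ℍ[ℝ] := ⟨a, b, c, 0⟩

@[simp] lemma paravector_re (a b c : ℝ) : (paravector a b c).re = a := rfl
@[simp] lemma paravector_imI (a b c : ℝ) : (paravector a b c).imI = b := rfl
@[simp] lemma paravector_imJ (a b c : ℝ) : (paravector a b c).imJ = c := rfl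
@[simp] lemma paravector_imK (a b c : ℝ) : (paravector a b c).imK = 0 := rfl

lemma e₁_eq : e₁ = paravector 0 1 0 := rfl
lemma e₂_eq : e₂ = paravector 0 0 1 := rfl

lemma pd_coord {F : R3 → ℍ[ℝ]} {x : R3} (hF : DifferentiableAt ℝ F x) (l : ℍ[ℝ] →L[ℝ] ℝ)
    (j : Fin 3) : pd j (fun y => l (F y)) x = l (partialD j F x) := by
  have h : fderiv ℝ (fun y => l (F y)) x = _ := (l.hasFDerivAt.comp x hF.hasFDerivAt).fderiv
  rw [pd, h]
  rfl

lemma paravector_eq (a b c : ℝ) : paravector a b c = a • (1 : ℍ[ℝ]) + b • e₁ + c • e₂ := by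
  ext <;> simp [e₁_eq, e₂_eq]

lemma partialD_paravector {f₀ f₁ f₂ : R3 → ℝ} {x : R3} (h₀ : DifferentiableAt ℝ f₀ x)
    (h₁ : DifferentiableAt ℝ f₁ x) (h₂ : DifferentiableAt ℝ f₂ x) (j : Fin 3) :
    partialD j (fun y => paravector (f₀ y) (f₁ y) (f₂ y)) x =
      paravector (pd j f₀ x) (pd j f₁ x) (pd j f₂ x) := by
  have h : fderiv ℝ (fun y => f₀ y • (1 : ℍ[ℝ]) + f₁ y • e₁ + f₂ y • e₂) x = _ :=
    (((h₀.hasFDerivAt.smul_const (1 : ℍ[ℝ])).add (h₁.hasFDerivAt.smul_const e₁)).add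
      (h₂.hasFDerivAt.smul_const e₂)).fderiv
  simp only [paravector_eq, partialD, h]
  rfl

lemma contDiff_paravector {f₀ f₁ f₂ : R3 → ℝ} {n : WithTop ℕ∞} (h₀ : ContDiff ℝ n f₀)
    (h₁ : ContDiff ℝ n f₁) (h₂ : ContDiff ℝ n f₂) :
    ContDiff ℝ n fun y => paravector (f₀ y) (f₁ y) (f₂ y) := by
  simp only [paravector_eq]
  fun_prop

lemma D_coe {u : R3 → ℝ} (hu : Differentiable ℝ u) (x : R3) :
    Ambigenic.D (fun y => (u y : ℍ[ℝ])) x = paravector (pd 0 u x) (-pd 1 u x) (-pd 2 u x) := by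
  have e : (fun y => (u y : ℍ[ℝ])) = fun y => paravector (u y) 0 0 := by ext y <;> simp
  have h := fun j => partialD_paravector (hu x) (differentiableAt_const (x := x) (0 : ℝ))
    (differentiableAt_const (x := x) (0 : ℝ)) j
  rw [Ambigenic.D, e, h, h, h]
  ext <;> simp [e₁_eq, e₂_eq, pd]

/-! ### Fields built from a gradient -/

/-- The function `(α ∂₀u, -β ∂₁u, -β ∂₂u)` on the unit ball. -/
def gradField (α β : ℝ) (u : R3 → ℝ) : unitBall → ℍ[ℝ] := fun x =>
  paravector (α * pd 0 u x) (-(β * pd 1 u x)) (-(β * pd 2 u x))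

lemma X_eq (n m : ℕ) : Ambigenic.X n m = gradField 1 1 (ev (polyU (n + 1) m)) := by
  funext x
  rw [Ambigenic.X, solidU_eq (Nat.succ_ne_zero n), D_coe (differentiable_ev _)]
  simp [gradField]

lemma Y_eq (n m : ℕ) : Ambigenic.Y n m = gradField 1 1 (ev (polyV (n + 1) m)) := by
  funext x
  rw [Ambigenic.Y, solidV_eq (Nat.succ_ne_zero n), D_coe (differentiable_ev _)]
  simp [gradField]

lemma conjMap_gradField (α β : ℝ) (u : R3 → ℝ) :
    conjMap unitBall (gradField α β u) = gradField α (-β) u := by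
  funext x
  change star (gradField α β u x) = _
  ext <;> simp [gradField]

lemma smul_gradField (c α β : ℝ) (u : R3 → ℝ) :
    c • gradField α β u = gradField (c * α) (c * β) u := by
  funext x
  ext <;> simp [gradField] <;> ring

lemma gradField_add (α β γ δ : ℝ) (u : R3 → ℝ) :
    gradField α β u + gradField γ δ u = gradField (α + γ) (β + δ) u := by
  funext x
  ext <;> simp [gradField] <;> ring

lemma gradField_sub (α β γ δ : ℝ) (u : R3 → ℝ) :
    gradField α β u - gradField γ δ u = gradField (α - γ) (β - δ) u := by
  funext x
  ext <;> simp [gradField] <;> ring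

lemma gradField_zero (α β : ℝ) : gradField α β 0 = 0 := by
  funext x
  ext <;> simp [gradField, pd_zero]

lemma inner_gradField (α β γ δ : ℝ) (p q : Poly) (x : unitBall) :
    inner ℝ (gradField α β (ev p) x) (gradField γ δ (ev q) x) =
      ev (gradForm (α * γ) (β * δ) p q) x := by
  rw [gradForm, ev_add, ev_C_mul, ev_C_mul, ev_add, ev_mul, ev_mul, ev_mul]
  simp [Quaternion.inner_def, gradField, pd_ev]
  ring

lemma isHomogeneous_gradForm {n : ℕ} {p q : Poly} (α β : ℝ) (hp : p.IsHomogeneous (n + 1))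
    (hq : q.IsHomogeneous (n + 1)) : (gradForm α β p q).IsHomogeneous (n + n) := by
  have h : ∀ j : Fin 3, (MvPolynomial.pderiv j p * MvPolynomial.pderiv j q).IsHomogeneous (n + n) :=
    fun j => (hp.pderiv (i := j)).mul (hq.pderiv (i := j))
  exact (isHomogeneous_C_mul _ (h 0)).add (isHomogeneous_C_mul _ ((h 1).add (h 2)))

lemma scalarProduct_gradField_eq_zero {n : ℕ} {α β γ δ : ℝ} {p q : Poly}
    (hp : p.IsHomogeneous (n + 1)) (hq : q.IsHomogeneous (n + 1))
    (h : gaussIntegral (gradForm (α * γ) (β * δ) p q) = 0) :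
    scalarProduct (gradField α β (ev p)) (gradField γ δ (ev q)) = 0 := by
  have e : ∀ x, (star (gradField α β (ev p) x) * gradField γ δ (ev q) x).re =
      ev (gradForm (α * γ) (β * δ) p q) x := fun x => by
    rw [← inner_gradField, Quaternion.inner_def]
    simp
  simp only [scalarProduct, e, ballVolume]
  exact (integral_subtype_comap (s := (unitBall : Set R3)) unitBall.isOpen.measurableSet
    (fun x => ev (gradForm (α * γ) (β * δ) p q) x)).trans
      (integral_ball_eq_zero (isHomogeneous_gradForm _ _ hp hq) h)

/-! #### The family in terms of polynomials -/

/-- `Û^N_m` or `V̂^N_m`. -/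
def harm (N : ℕ) : Bool → ℕ → Poly
  | false, m => polyU N m
  | true, m => polyV N m

lemma isHomogeneous_harm (N : ℕ) (b : Bool) (m : ℕ) : (harm N b m).IsHomogeneous N := by
  cases b
  exacts [isHomogeneous_polyU N m, isHomogeneous_polyV N m]

lemma lap_harm (N : ℕ) (b : Bool) (m : ℕ) : lap (harm N b m) = 0 := by
  cases b
  exacts [lap_polyU N m, lap_polyV N m]

lemma rot_rot_harm (N : ℕ) (b : Bool) (m : ℕ) :
    rot (rot (harm N b m)) = C (-(m : ℝ) ^ 2) * harm N b m := by
  cases b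
  exacts [rot_rot_polyU N m, rot_rot_polyV N m]

lemma pderiv_zero_harm (n : ℕ) (b : Bool) (m : ℕ) :
    MvPolynomial.pderiv 0 (harm (n + 1) b m) = C ((n : ℝ) + 1 + m) * harm n b m := by
  cases b
  exacts [pderiv_zero_polyU n m, pderiv_zero_polyV n m]

lemma harm_ne_zero {N m : ℕ} {b : Bool} (hb : b = true → m ≠ 0) (hm : m ≤ N) : harm N b m ≠ 0 := by
  cases b
  exacts [polyU_ne_zero hm, polyV_ne_zero (hb rfl) hm]

/-! ### Gaussian orthogonality and positivity for the family -/

lemma gaussIntegral_gradForm_harm (N : ℕ) (α β : ℝ) {b c : Bool} {m l : ℕ} (hb : b = true → m ≠ 0)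
    (hc : c = true → l ≠ 0) (h : ¬(b = c ∧ m = l)) :
    gaussIntegral (gradForm α β (harm N b m) (harm N c l)) = 0 := by
  rcases eq_or_ne m l with rfl | hml
  · cases b <;> cases c <;> simp only [and_true, not_true_eq_false] at h
    · refine map_gradForm_of_rot_eq gaussIntegral_pderiv α β (c := -(m : ℝ)) ?_ (rot_polyU N m)
      exact neg_ne_zero.2 (by exact_mod_cast hc rfl)
    · refine map_gradForm_of_rot_eq gaussIntegral_pderiv α β (c := (m : ℝ)) ?_ (rot_polyV N m)
      exact_mod_cast hb rfl
  · refine map_gradForm_of_weight_ne gaussIntegral_pderiv α β (m := m) (l := l) ?_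
      (rot_rot_harm N b m) (rot_rot_harm N c l)
    have : m ^ 2 ≠ l ^ 2 := fun h => hml (Nat.pow_left_injective two_ne_zero h)
    exact_mod_cast this

lemma a_of_le {n m : ℕ} (h : m ≤ n) : Ambigenic.a n m =
    ((n : ℝ) - 2 * (m : ℝ) ^ 2 + 1) / (((n : ℝ) + 1) * (2 * (n : ℝ) + 1)) :=
  if_neg (by omega)

lemma a_succ (n : ℕ) : Ambigenic.a n (n + 1) = 0 := if_pos rfl

lemma gaussIntegral_plus_minus {n m : ℕ} (hm : m ≤ n) (b : Bool) :
    gaussIntegral (gradForm (1 - Ambigenic.a n m) (-1 - Ambigenic.a n m) (harm (n + 1) b m)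
      (harm (n + 1) b m)) = 0 := by
  have h := map_gradForm_weight gaussIntegral_pderiv (isHomogeneous_harm (n + 1) b m)
    (lap_harm (n + 1) b m) (rot_rot_harm (n + 1) b m)
  rw [← a_of_le hm] at h
  have e : gradForm (1 - Ambigenic.a n m) (-1 - Ambigenic.a n m) (harm (n + 1) b m)
      (harm (n + 1) b m) = gradForm 1 (-1) (harm (n + 1) b m) (harm (n + 1) b m) -
      C (Ambigenic.a n m) * gradForm 1 1 (harm (n + 1) b m) (harm (n + 1) b m) := by
    simp only [gradForm, MvPolynomial.C_sub, map_neg, map_one]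
    ring
  rw [e, map_sub, map_C_mul, h, sub_self]

lemma gaussIntegral_eq_zero {p : Poly} (h : ∀ x, ev p x = 0) : gaussIntegral p = 0 := by
  change ∫ x, ev p x * gauss x = 0
  simp [h]

lemma gaussIntegral_mul_self_nonneg (p : Poly) : 0 ≤ gaussIntegral (p * p) := by
  refine integral_nonneg fun x => mul_nonneg ?_ (Real.exp_pos _).le
  rw [ev_mul]
  exact mul_self_nonneg _

lemma gaussIntegral_mul_self_pos {p : Poly} (hp : p ≠ 0) : 0 < gaussIntegral (p * p) := by
  obtain ⟨v, hv⟩ : ∃ v, MvPolynomial.eval v p ≠ 0 := by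
    by_contra! h
    exact hp (MvPolynomial.funext fun v => by rw [h, map_zero])
  refine integral_pos_of_integrable_nonneg_nonzero (x := WithLp.toLp 2 v)
    ((continuous_ev _).mul contDiff_gauss.continuous) (integrable_ev_mul_gauss _) (fun x => ?_) ?_
  · rw [ev_mul]
    exact mul_nonneg (mul_self_nonneg _) (Real.exp_pos _).le
  · rw [ev_mul]
    exact mul_ne_zero (mul_self_ne_zero.2 hv) (Real.exp_pos _).ne'

lemma gaussIntegral_plus_pos {n m : ℕ} {b : Bool} (hb : b = true → m ≠ 0) (hm : m ≤ n + 1) :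
    0 < gaussIntegral (gradForm 1 1 (harm (n + 1) b m) (harm (n + 1) b m)) := by
  rw [map_gradForm_one_one gaussIntegral_pderiv (isHomogeneous_harm _ _ _) (lap_harm _ _ _)]
  have := gaussIntegral_mul_self_pos (harm_ne_zero hb hm)
  positivity

/-- a = 1 would mean 2n(n+1) + 2m² = 0. This does occur for n = m = 0, where X is real and X⁻ = 0.
-/
lemma a_ne_one {n m : ℕ} (hn : 0 < n) (hm : m ≤ n) : 1 - Ambigenic.a n m ≠ 0 := by
  rw [a_of_le hm]
  intro h
  have h1 : (n : ℝ) + 1 ≠ 0 := by positivity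
  have h2 : 2 * (n : ℝ) + 1 ≠ 0 := by positivity
  field_simp at h
  have : (0 : ℝ) < n := by exact_mod_cast hn
  nlinarith [sq_nonneg (m : ℝ)]

/-- For m ≤ n the ∂₀ term alone is positive. For m = n+1 that term vanishes, but a = 0 makes the
form that of the plus function. -/
lemma gaussIntegral_minus_pos {n m : ℕ} {b : Bool} (hn : 0 < n) (hb : b = true → m ≠ 0)
    (hm : m ≤ n + 1) :
    0 < gaussIntegral (gradForm ((1 - Ambigenic.a n m) * (1 - Ambigenic.a n m))
      ((-1 - Ambigenic.a n m) * (-1 - Ambigenic.a n m)) (harm (n + 1) b m) (harm (n + 1) b m)) := by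
  rcases Nat.lt_or_ge n m with h | h
  · obtain rfl : m = n + 1 := by omega
    rw [a_succ]
    norm_num
    exact gaussIntegral_plus_pos hb hm
  · have h0 : 0 < gaussIntegral (MvPolynomial.pderiv 0 (harm (n + 1) b m) *
        MvPolynomial.pderiv 0 (harm (n + 1) b m)) := by
      refine gaussIntegral_mul_self_pos fun h1 => harm_ne_zero hb h ?_
      rw [pderiv_zero_harm] at h1
      exact C_mul_eq_zero (by positivity) h1
    have h1 := gaussIntegral_mul_self_nonneg (MvPolynomial.pderiv 1 (harm (n + 1) b m))
    have h2 := gaussIntegral_mul_self_nonneg (MvPolynomial.pderiv 2 (harm (n + 1) b m))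
    rw [gradForm, map_add, map_C_mul, map_C_mul, map_add]
    have h3 : 0 < (1 - Ambigenic.a n m) * (1 - Ambigenic.a n m) :=
      mul_self_pos.2 (a_ne_one hn h)
    have h4 := mul_self_nonneg (-1 - Ambigenic.a n m)
    exact add_pos_of_pos_of_nonneg (mul_pos h3 h0) (mul_nonneg h4 (add_nonneg h1 h2))

/-- The index set of the family. -/
abbrev Index (n : ℕ) : Type := Fin (n + 2) ⊕ Fin n ⊕ Fin (n + 1) ⊕ Fin (n + 1)

/-- Whether a member of the family is built from `V̂`. -/
def Index.isSin {n : ℕ} : Index n → Bool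
  | Sum.inl _ => false
  | Sum.inr (Sum.inl _) => true
  | Sum.inr (Sum.inr (Sum.inl _)) => false
  | Sum.inr (Sum.inr (Sum.inr _)) => true

/-- The order `m` of a member of the family. -/
def Index.order {n : ℕ} : Index n → ℕ
  | Sum.inl m => m
  | Sum.inr (Sum.inl m) => m + 1
  | Sum.inr (Sum.inr (Sum.inl m)) => m
  | Sum.inr (Sum.inr (Sum.inr m)) => m + 1

/-- Whether a member of the family carries the sign `-`. -/
def Index.isMinus {n : ℕ} : Index n → Bool
  | Sum.inl _ => false
  | Sum.inr (Sum.inl _) => false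
  | Sum.inr (Sum.inr (Sum.inl _)) => true
  | Sum.inr (Sum.inr (Sum.inr _)) => true

/-- The coefficient of `∂₀` in a member of the family. -/
def Index.scalarCoeff {n : ℕ} (i : Index n) : ℝ :=
  if i.isMinus then 1 - Ambigenic.a n i.order else 1

/-- The coefficient of the remaining derivatives in a member of the family. -/
def Index.vectorCoeff {n : ℕ} (i : Index n) : ℝ :=
  if i.isMinus then -1 - Ambigenic.a n i.order else 1

/-- The harmonic polynomial from which a member of the family is built. -/
def Index.poly {n : ℕ} (i : Index n) : Poly := harm (n + 1) i.isSin i.order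

lemma family_eq {n : ℕ} (i : Index n) :
    family n i = gradField i.scalarCoeff i.vectorCoeff (ev i.poly) := by
  rcases i with m | m | m | m
  · exact X_eq n m
  · exact Y_eq n (m + 1)
  · change conjMap unitBall (Ambigenic.X n m) - Ambigenic.a n m • Ambigenic.X n m = _
    rw [X_eq, conjMap_gradField, smul_gradField, gradField_sub, mul_one]
    rfl
  · change conjMap unitBall (Ambigenic.Y n (m + 1)) -
      Ambigenic.a n (m + 1) • Ambigenic.Y n (m + 1) = _
    rw [Y_eq, conjMap_gradField, smul_gradField, gradField_sub, mul_one]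
    rfl

lemma Index.order_ne_zero {n : ℕ} (i : Index n) (h : i.isSin = true) : i.order ≠ 0 := by
  rcases i with m | m | m | m <;> simp_all [Index.isSin, Index.order]

lemma Index.order_le {n : ℕ} (i : Index n) : i.order ≤ n + 1 := by
  rcases i with m | m | m | m <;> simp only [Index.order] <;> omega

lemma Index.ext {n : ℕ} {i j : Index n} (h1 : i.isSin = j.isSin) (h2 : i.order = j.order)
    (h3 : i.isMinus = j.isMinus) : i = j := by
  rcases i with i | i | i | i <;> rcases j with j | j | j | j <;>
    simp_all [Index.isSin, Index.order, Index.isMinus, Fin.ext_iff]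

/-- At order n+1 the cosine occurs only with plus and the sine only with minus, so the formula for a
with m ≤ n suffices. -/
lemma Index.order_le_of_plus_minus {n : ℕ} {i j : Index n} (h1 : i.isSin = j.isSin)
    (h2 : i.order = j.order) (h3 : i.isMinus = false) (h4 : j.isMinus = true) : i.order ≤ n := by
  rcases i with i | i | i | i <;> rcases j with j | j | j | j <;>
    simp_all [Index.isSin, Index.order, Index.isMinus] <;> omega

lemma gaussIntegral_family {n : ℕ} {i j : Index n} (hij : i ≠ j) :
    gaussIntegral (gradForm (i.scalarCoeff * j.scalarCoeff) (i.vectorCoeff * j.vectorCoeff)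
      i.poly j.poly) = 0 := by
  by_cases h : i.isSin = j.isSin ∧ i.order = j.order
  · obtain ⟨h1, h2⟩ := h
    have key : ∀ {i j : Index n}, i.isSin = j.isSin → i.order = j.order → i.isMinus = false →
        j.isMinus = true → gaussIntegral (gradForm (i.scalarCoeff * j.scalarCoeff)
          (i.vectorCoeff * j.vectorCoeff) i.poly j.poly) = 0 := by
      intro i j h1 h2 h3 h4
      have := gaussIntegral_plus_minus (Index.order_le_of_plus_minus h1 h2 h3 h4) i.isSin
      simpa [Index.scalarCoeff, Index.vectorCoeff, Index.poly, h3, h4, ← h1, ← h2] using this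
    cases h3 : i.isMinus <;> cases h4 : j.isMinus
    · exact absurd (Index.ext h1 h2 (h3.trans h4.symm)) hij
    · exact key h1 h2 h3 h4
    · rw [gradForm_comm, mul_comm, mul_comm i.vectorCoeff]
      exact key h1.symm h2.symm h4 h3
    · exact absurd (Index.ext h1 h2 (h3.trans h4.symm)) hij
  · exact gaussIntegral_gradForm_harm (n + 1) _ _ i.order_ne_zero j.order_ne_zero h

lemma gaussIntegral_family_self_pos {n : ℕ} (hn : 0 < n) (i : Index n) :
    0 < gaussIntegral (gradForm (i.scalarCoeff * i.scalarCoeff) (i.vectorCoeff * i.vectorCoeff)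
      i.poly i.poly) := by
  cases h : i.isMinus
  · have := gaussIntegral_plus_pos (b := i.isSin) i.order_ne_zero i.order_le
    simpa [Index.scalarCoeff, Index.vectorCoeff, Index.poly, h] using this
  · have := gaussIntegral_minus_pos hn (b := i.isSin) i.order_ne_zero i.order_le
    simpa [Index.scalarCoeff, Index.vectorCoeff, Index.poly, h] using this

/-! ### Orthogonality on the ball and linear independence -/

theorem scalarProduct_family {n : ℕ} {i j : Index n} (hij : i ≠ j) :
    scalarProduct (family n i) (family n j) = 0 := by
  rw [family_eq, family_eq]
  exact scalarProduct_gradField_eq_zero (isHomogeneous_harm _ _ _) (isHomogeneous_harm _ _ _)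
    (gaussIntegral_family hij)

lemma mem_unitBall {x : R3} : x ∈ unitBall ↔ ‖x‖ < 1 := mem_ball_zero_iff

lemma inv_smul_mem_unitBall (x : R3) : (1 + ‖x‖)⁻¹ • x ∈ unitBall := by
  have h1 : 0 < 1 + ‖x‖ := by positivity
  rw [mem_unitBall, norm_smul, Real.norm_of_nonneg (by positivity), inv_mul_lt_one₀ h1]
  linarith

/-- Pairing a relation pointwise with member j gives a homogeneous polynomial vanishing on the ball,
hence everywhere. Its Gaussian integral is c_j times a positive number. -/
theorem linearIndependent_family {n : ℕ} (hn : 0 < n) : LinearIndependent ℝ (family n) := by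
  rw [Fintype.linearIndependent_iff]
  intro (c : Index n → ℝ) (hc : ∑ i : Index n, c i • family n i = 0) (j : Index n)
  set Q : Index n → Poly := fun i => gradForm (i.scalarCoeff * j.scalarCoeff)
    (i.vectorCoeff * j.vectorCoeff) i.poly j.poly with hQ
  have hhom : (∑ i, C (c i) * Q i).IsHomogeneous (n + n) :=
    MvPolynomial.IsHomogeneous.sum _ _ _ fun i _ => isHomogeneous_C_mul _
      (isHomogeneous_gradForm _ _ (isHomogeneous_harm _ _ _) (isHomogeneous_harm _ _ _))
  have hev : ∀ x : R3, ev (∑ i, C (c i) * Q i) x = ∑ i, c i * ev (Q i) x := fun x => by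
    simp only [ev, map_sum, map_mul, MvPolynomial.eval_C]
  have hball : ∀ x : unitBall, ev (∑ i, C (c i) * Q i) x = 0 := fun x => by
    have h := congrFun hc x
    rw [Finset.sum_apply] at h
    have h2 := congrArg (fun q => inner ℝ q (family n j x)) h
    simp only [Pi.smul_apply, Pi.zero_apply, inner_zero_left, sum_inner, real_inner_smul_left]
      at h2
    rw [hev, ← h2]
    refine Finset.sum_congr rfl fun i _ => ?_
    rw [family_eq, family_eq, inner_gradField]
  have hzero : ∀ x : R3, ev (∑ i, C (c i) * Q i) x = 0 := fun x => by
    have h := hball ⟨_, inv_smul_mem_unitBall x⟩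
    rw [ev_smul hhom] at h
    exact (mul_eq_zero.1 h).resolve_left (by positivity)
  have hJ := gaussIntegral_eq_zero hzero
  rw [map_sum, Finset.sum_eq_single j] at hJ
  · rw [map_C_mul] at hJ
    exact (mul_eq_zero.1 hJ).resolve_right (gaussIntegral_family_self_pos hn j).ne'
  · intro i _ hij
    rw [map_C_mul, gaussIntegral_family hij, mul_zero]
  · exact fun h => absurd (Finset.mem_univ j) h

end SolidHarmonic

namespace SolidHarmonic
open scoped ContDiff
open MeasureTheory
open Ambigenic (R3 unitBall conjMap ambigenic monogenic homogeneousAmbigenic family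
  ballVolume partialD e₁ e₂ Dbar)

/-! ### The span of the family contains all gradient fields -/

/-- The coefficient vectors (1, 1) and (1-a, -1-a) have determinant -2 for every a, so they generate
all (α, β). -/
lemma gradField_eq_combination (α β a : ℝ) (u : R3 → ℝ) :
    gradField α β u = (α - (α - β) / 2 * (1 - a)) • gradField 1 1 u +
      ((α - β) / 2) • gradField (1 - a) (-1 - a) u := by
  rw [smul_gradField, smul_gradField, gradField_add]
  congr 1 <;> ring

lemma gradField_eq_of_pd_zero {u : R3 → ℝ} (h : pd 0 u = 0) (α γ β : ℝ) :
    gradField α β u = gradField γ β u := by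
  funext x
  simp [gradField, h]

lemma harm_of_lt {N m : ℕ} (h : N < m) (b : Bool) : harm N b m = 0 := by
  cases b <;> exact zonalMul_of_lt h _

lemma gradField_harm_mem_span (n : ℕ) (b : Bool) (m : ℕ) (α β : ℝ) :
    gradField α β (ev (harm (n + 1) b m)) ∈ Submodule.span ℝ (Set.range (family n)) := by
  have hmem : ∀ i : Index n, gradField i.scalarCoeff i.vectorCoeff (ev i.poly) ∈
      Submodule.span ℝ (Set.range (family n)) := fun i => by
    rw [← family_eq]
    exact Submodule.subset_span ⟨i, rfl⟩
  have hzero : ∀ p : Poly, p = 0 →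
      gradField α β (ev p) ∈ Submodule.span ℝ (Set.range (family n)) := fun p hp => by
    rw [hp, ev_zero, gradField_zero]
    exact Submodule.zero_mem _
  have hpair : ∀ i j : Index n, i.isMinus = false → j.isMinus = true → i.poly = j.poly →
      gradField α β (ev i.poly) ∈ Submodule.span ℝ (Set.range (family n)) := by
    intro i j hi hj hij
    have h1 := hmem i
    have h2 := hmem j
    simp only [Index.scalarCoeff, Index.vectorCoeff, hi, hj, ← hij, Bool.false_eq_true,
      if_true, if_false] at h1 h2
    rw [gradField_eq_combination α β (Ambigenic.a n j.order)]
    exact Submodule.add_mem _ (Submodule.smul_mem _ _ h1) (Submodule.smul_mem _ _ h2)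
  -- In the sectorial case ∂₀ vanishes, α is irrelevant, and the single available sign suffices.
  have hsect : ∀ i : Index n, i.order = n + 1 → ∀ c : ℝ, c * i.vectorCoeff = β →
      gradField α β (ev i.poly) ∈ Submodule.span ℝ (Set.range (family n)) := by
    intro i hi c hc
    have h0 : pd 0 (ev i.poly) = 0 := by
      rw [pd_ev, Index.poly, pderiv_zero_harm, hi, harm_of_lt (Nat.lt_succ_self n), mul_zero,
        ev_zero]
    have := Submodule.smul_mem _ c (hmem i)
    rwa [smul_gradField, hc, gradField_eq_of_pd_zero h0 _ α] at this
  rcases Nat.lt_or_ge (n + 1) m with h | h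
  · exact hzero _ (harm_of_lt h b)
  cases b
  · rcases h.lt_or_eq with h | rfl
    · exact hpair (Sum.inl ⟨m, by omega⟩) (Sum.inr (Sum.inr (Sum.inl ⟨m, h⟩))) rfl rfl rfl
    · exact hsect (Sum.inl ⟨n + 1, by omega⟩) rfl β (mul_one β)
  · rcases m with _ | m
    · exact hzero _ (polyV_zero _)
    · rcases h.lt_or_eq with h | h
      · exact hpair (Sum.inr (Sum.inl ⟨m, by omega⟩))
          (Sum.inr (Sum.inr (Sum.inr ⟨m, by omega⟩))) rfl rfl rfl
      · obtain rfl : m = n := by omega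
        refine hsect (Sum.inr (Sum.inr (Sum.inr ⟨m, by omega⟩))) rfl (-β) ?_
        change -β * (-1 - Ambigenic.a m (m + 1)) = β
        rw [a_succ]
        ring

lemma gradField_add_fun {u v : R3 → ℝ} (hu : Differentiable ℝ u) (hv : Differentiable ℝ v)
    (α β : ℝ) : gradField α β (u + v) = gradField α β u + gradField α β v := by
  funext x
  ext <;> simp [gradField, pd_add (hu x) (hv x)] <;> ring

lemma gradField_smul_fun {u : R3 → ℝ} (hu : Differentiable ℝ u) (c α β : ℝ) :
    gradField α β (c • u) = c • gradField α β u := by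
  funext x
  ext <;> simp [gradField, pd_const_smul (hu x)] <;> ring

lemma gradField_mem_span {n : ℕ} {u : R3 → ℝ} (hu : u ∈ solidSpan (n + 1)) (α β : ℝ) :
    gradField α β u ∈ Submodule.span ℝ (Set.range (family n)) := by
  have hd : ∀ v ∈ solidSpan (n + 1), Differentiable ℝ v := fun v hv =>
    (solidSpan_le_harmonicHom _ hv).1.differentiable_infty
  induction hu using Submodule.span_induction with
  | mem u h =>
    rcases h with ⟨m, rfl⟩ | ⟨m, rfl⟩
    · exact gradField_harm_mem_span n false m α β
    · exact gradField_harm_mem_span n true m α β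
  | zero =>
    rw [gradField_zero]
    exact Submodule.zero_mem _
  | add u v hu hv ihu ihv =>
    rw [gradField_add_fun (hd u hu) (hd v hv)]
    exact Submodule.add_mem _ ihu ihv
  | smul c u hu ih =>
    rw [gradField_smul_fun (hd u hu)]
    exact Submodule.smul_mem _ c ih

/-! ### Gradient fields are homogeneous ambigenic functions -/

instance : IsFiniteMeasure ballVolume := by
  refine ⟨(comap_subtype_coe_apply (s := (unitBall : Set R3)) unitBall.isOpen.measurableSet
    volume Set.univ).trans_lt ?_⟩
  rw [Set.image_univ, Subtype.range_coe]
  exact measure_ball_lt_top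

/-- The field is D p, and D̄D is the Laplacian. -/
lemma gradField_one_one_mem_monogenic {p : Poly} (hl : lap p = 0) :
    gradField 1 1 (ev p) ∈ monogenic unitBall := by
  have hs : ∀ j, ContDiff ℝ ∞ (pd j (ev p)) := fun j => contDiff_pd_infty j (contDiff_ev p)
  have hd : ∀ j x, DifferentiableAt ℝ (pd j (ev p)) x := fun j => (hs j).differentiable_infty
  refine ⟨fun y => paravector (pd 0 (ev p) y) ((-pd 1 (ev p)) y) ((-pd 2 (ev p)) y), ?_,
    fun _ _ => rfl, fun x _ => ?_, fun x => ?_⟩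
  · exact ((contDiff_paravector (hs 0) (hs 1).neg (hs 2).neg).of_le (by simp)).contDiffOn
  · have hP := fun j => partialD_paravector (hd 0 x) (hd 1 x).neg (hd 2 x).neg j
    have h0 : pd 0 (pd 0 (ev p)) x + pd 1 (pd 1 (ev p)) x + pd 2 (pd 2 (ev p)) x = 0 := by
      simp only [pd_ev]
      have := congrArg (fun q => ev q x) hl
      simpa only [lap, ev_add, ev_zero, Pi.add_apply, Pi.zero_apply] using this
    have hc : ∀ i j, pd i (pd j (ev p)) x = pd j (pd i (ev p)) x := fun i j =>
      congrFun (pd_comm (contDiff_ev p) i j) x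
    rw [Dbar, hP, hP, hP]
    ext <;> simp [e₁_eq, e₂_eq, pd_neg]
    · linarith
    · linarith [hc 0 1]
    · linarith [hc 0 2]
    · linarith [hc 1 2]
  · simp [gradField]

lemma gradField_mem_ambigenic {p : Poly} (hl : lap p = 0) (α β : ℝ) :
    gradField α β (ev p) ∈ ambigenic unitBall := by
  have h1 := gradField_one_one_mem_monogenic hl
  have h2 := Submodule.mem_map_of_mem (f := conjMap unitBall) h1
  rw [conjMap_gradField] at h2
  have h := gradField_eq_combination α β 0 (ev p)
  rw [sub_zero, sub_zero] at h
  rw [h]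
  exact Submodule.add_mem _ (Submodule.mem_sup_left (Submodule.smul_mem _ _ h1))
    (Submodule.mem_sup_right (Submodule.smul_mem _ _ h2))

lemma memLp_gradField (α β : ℝ) (p : Poly) : MemLp (gradField α β (ev p)) 2 ballVolume := by
  have hs : ∀ j, ContDiff ℝ ∞ (pd j (ev p)) := fun j => contDiff_pd_infty j (contDiff_ev p)
  have hc := (contDiff_paravector (contDiff_const.mul (hs 0)) (contDiff_const.mul (hs 1)).neg
    (contDiff_const.mul (hs 2)).neg : ContDiff ℝ ∞ fun y => paravector (α * pd 0 (ev p) y)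
      (-(β * pd 1 (ev p) y)) (-(β * pd 2 (ev p) y))).continuous
  obtain ⟨c, hc'⟩ := (isCompact_closedBall (0 : R3) 1).exists_bound_of_continuousOn hc.continuousOn
  refine MemLp.of_bound (hc.comp continuous_subtype_val).aestronglyMeasurable c
    (ae_of_all _ fun x => hc' x ?_)
  exact Metric.ball_subset_closedBall x.2

lemma isHomogeneous_gradField {n : ℕ} {p : Poly} (hp : p.IsHomogeneous (n + 1)) (α β : ℝ) :
    Ambigenic.IsHomogeneous n (gradField α β (ev p)) := by
  intro t _ x y hxy
  have h : ∀ j, pd j (ev p) y = t ^ n * pd j (ev p) x := fun j => by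
    rw [pd_ev, hxy]
    exact ev_smul (hp.pderiv (i := j)) t x
  ext <;> simp [gradField, h] <;> ring

lemma family_mem_homogeneousAmbigenic (n : ℕ) (i : Index n) :
    family n i ∈ homogeneousAmbigenic n := by
  rw [family_eq]
  exact ⟨gradField_mem_ambigenic (lap_harm _ _ _) _ _, memLp_gradField _ _ _,
    isHomogeneous_gradField (isHomogeneous_harm _ _ _) _ _⟩

/-! ### Monogenic functions as harmonic vector fields -/

/-- The linear functionals `f₀`, `-f₁`, `-f₂`. -/
def conjCoord : Fin 3 → (ℍ[ℝ] →L[ℝ] ℝ) := ![coordRe, -coordI, -coordJ]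

lemma conjCoord_zero (q : ℍ[ℝ]) : conjCoord 0 q = q.re := rfl
lemma conjCoord_one (q : ℍ[ℝ]) : conjCoord 1 q = -q.imI := rfl
lemma conjCoord_two (q : ℍ[ℝ]) : conjCoord 2 q = -q.imJ := rfl

/-- Curl freeness gives ΔG_k = ∂_k(div G). -/
lemma sum_pd_pd_eq_zero_of_div_curl_free {G : Fin 3 → R3 → ℝ} {Ω : Set R3} (hΩ : IsOpen Ω)
    (hG : ∀ k, ∀ z ∈ Ω, ContDiffAt ℝ ∞ (G k) z)
    (hcurl : ∀ i k, ∀ z ∈ Ω, pd i (G k) z = pd k (G i) z)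
    (hdiv : ∀ z ∈ Ω, ∑ i, pd i (G i) z = 0) (k : Fin 3) {x : R3} (hx : x ∈ Ω) :
    ∑ i, pd i (pd i (G k)) x = 0 := by
  have hnear := hΩ.mem_nhds hx
  have h1 : ∀ i, pd i (pd i (G k)) x = pd k (pd i (G i)) x := fun i => by
    rw [← pd_pd_comm ((hG i x hx).of_le (by norm_cast)) i k]
    refine pd_congr ?_ i
    filter_upwards [hnear] with z hz using hcurl i k z hz
  have h2 : ∀ i, DifferentiableAt ℝ (pd i (G i)) x := fun i =>
    (contDiffAt_pd (m := 1) i (hG i x hx) (by norm_cast)).differentiableAt (by simp)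
  have h3 : pd 0 (G 0) + pd 1 (G 1) + pd 2 (G 2) =ᶠ[nhds x] 0 := by
    filter_upwards [hnear] with z hz
    simpa [Fin.sum_univ_three] using hdiv z hz
  have h4 := pd_congr h3 k
  rw [pd_add ((h2 0).add (h2 1)) (h2 2), pd_add (h2 0) (h2 1), pd_zero] at h4
  simpa [h1, Fin.sum_univ_three] using h4

section
variable {Ω : Set R3} {F : R3 → ℍ[ℝ]} (hΩ : IsOpen Ω) (hF : ContDiffOn ℝ 1 F Ω)
  (hK : ∀ x ∈ Ω, (F x).imK = 0) (hD : ∀ x ∈ Ω, Dbar F x = 0)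
include hΩ hF hK hD

/-- The four quaternion components of D̄F = 0 are the divergence and curl equations for (F₀, -F₁,
-F₂), once the derivatives of the e₃ component are known to vanish. -/
lemma curl_and_div_eq_zero_of_monogenic {x : R3} (hx : x ∈ Ω) :
    (∀ i k, pd i (fun y => conjCoord k (F y)) x = pd k (fun y => conjCoord i (F y)) x) ∧
      ∑ i, pd i (fun y => conjCoord i (F y)) x = 0 := by
  have hd : DifferentiableAt ℝ F x :=
    (hF.differentiableOn one_ne_zero).differentiableAt (hΩ.mem_nhds hx)
  have hK' : ∀ j, (partialD j F x).imK = 0 := fun j => by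
    have h1 : (fun y => coordK (F y)) =ᶠ[nhds x] 0 := by
      filter_upwards [hΩ.mem_nhds hx] with z hz using hK z hz
    rw [← coordK_apply, ← pd_coord hd, pd_congr h1, pd_zero]
    rfl
  have h := hD x hx
  rw [Dbar] at h
  have h0 := congrArg QuaternionAlgebra.re h
  have h1 := congrArg QuaternionAlgebra.imI h
  have h2 := congrArg QuaternionAlgebra.imJ h
  have h3 := congrArg QuaternionAlgebra.imK h
  simp [e₁_eq, e₂_eq, hK'] at h0 h1 h2 h3
  simp only [pd_coord hd, Fin.sum_univ_three]
  refine ⟨fun i k => ?_, ?_⟩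
  · fin_cases i <;> fin_cases k <;>
      simp only [Fin.zero_eta, Fin.mk_one, Fin.reduceFinMk, conjCoord_zero, conjCoord_one,
        conjCoord_two] <;> linarith
  · simp only [conjCoord_zero, conjCoord_one, conjCoord_two]
    linarith

lemma contDiffAt_conjCoord_of_monogenic (k : Fin 3) {x : R3} (hx : x ∈ Ω) :
    ContDiffAt ℝ ∞ (fun y => conjCoord k (F y)) x :=
  contDiffAt_of_div_curl_free (G := fun k y => conjCoord k (F y)) hΩ
    (fun k => (conjCoord k).contDiff.comp_contDiffOn hF)
    (fun i k _ hz => (curl_and_div_eq_zero_of_monogenic hΩ hF hK hD hz).1 i k)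
    (fun _ hz => (curl_and_div_eq_zero_of_monogenic hΩ hF hK hD hz).2) k hx

lemma sum_pd_pd_conjCoord_of_monogenic (k : Fin 3) {x : R3} (hx : x ∈ Ω) :
    ∑ i, pd i (pd i (fun y => conjCoord k (F y))) x = 0 :=
  sum_pd_pd_eq_zero_of_div_curl_free (G := fun k y => conjCoord k (F y)) hΩ
    (fun k _ hz => contDiffAt_conjCoord_of_monogenic hΩ hF hK hD k hz)
    (fun i k _ hz => (curl_and_div_eq_zero_of_monogenic hΩ hF hK hD hz).1 i k)
    (fun _ hz => (curl_and_div_eq_zero_of_monogenic hΩ hF hK hD hz).2) k hx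

end

/-! ### Homogeneous ambigenic functions -/

lemma sum_pd_pd_add_smul {u v : R3 → ℝ} {x : R3} (hu : ∀ᶠ y in nhds x, ContDiffAt ℝ ∞ u y)
    (hv : ∀ᶠ y in nhds x, ContDiffAt ℝ ∞ v y) (c : ℝ) :
    ∑ i, pd i (pd i (u + c • v)) x = ∑ i, pd i (pd i u) x + c * ∑ i, pd i (pd i v) x := by
  have hd : ∀ {w : R3 → ℝ} {y : R3}, ContDiffAt ℝ ∞ w y → DifferentiableAt ℝ w y := fun h =>
    h.differentiableAt (by simp)
  have hd' : ∀ {w : R3 → ℝ} (i : Fin 3), (∀ᶠ y in nhds x, ContDiffAt ℝ ∞ w y) →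
      DifferentiableAt ℝ (pd i w) x := fun i h => hd (contDiffAt_pd i h.self_of_nhds (by simp))
  rw [Finset.mul_sum, ← Finset.sum_add_distrib]
  refine Finset.sum_congr rfl fun i _ => ?_
  have h : pd i (u + c • v) =ᶠ[nhds x] pd i u + c • pd i v := by
    filter_upwards [hu, hv] with y hy1 hy2
    rw [pd_add (hd hy1) ((hd hy2).const_smul c), pd_const_smul (hd hy2)]
    rfl
  rw [pd_congr h, pd_add (hd' i hu) ((hd' i hv).const_smul c), pd_const_smul (hd' i hv)]

/-- On the unit ball a homogeneous ambigenic function has the components of a global harmonic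
field, up to sign, whose planar part is curl free. -/
lemma exists_harmonicHom_of_mem_homogeneousAmbigenic {n : ℕ} {f : unitBall → ℍ[ℝ]}
    (hf : f ∈ homogeneousAmbigenic n) :
    ∃ E : Fin 3 → R3 → ℝ, (∀ k, E k ∈ harmonicHom n) ∧ pd 1 (E 2) = pd 2 (E 1) ∧
      ∀ x : unitBall, f x = paravector (E 0 x) (-E 1 x) (-E 2 x) := by
  obtain ⟨hamb, -, hhom⟩ := hf
  obtain ⟨g, ⟨F, hF, hFK, hFD, hgF⟩, _, ⟨h, ⟨H, hH, hHK, hHD, hhH⟩, rfl⟩, rfl⟩ :=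
    Submodule.mem_sup.1 hamb
  -- For f = g + conj h, conjugation changes the sign of components 1 and 2 of the field of h. Each
  -- sum stays harmonic, and the common sign -1 preserves the planar curl equation.
  set u : Fin 3 → R3 → ℝ := fun k y => conjCoord k (F y) with hu
  set v : Fin 3 → R3 → ℝ := fun k y => conjCoord k (H y) with hv
  set s : Fin 3 → ℝ := ![1, -1, -1] with hs
  set W : Fin 3 → R3 → ℝ := fun k => u k + s k • v k with hW
  have hB : IsOpen (unitBall : Set R3) := unitBall.isOpen
  have hmem : ∀ {x : R3}, ‖x‖ < 1 → x ∈ (unitBall : Set R3) := fun hx => mem_unitBall.2 hx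
  have hus : ∀ k, ∀ x ∈ (unitBall : Set R3), ContDiffAt ℝ ∞ (u k) x := fun k x hx =>
    contDiffAt_conjCoord_of_monogenic hB hF hFK hFD k hx
  have hvs : ∀ k, ∀ x ∈ (unitBall : Set R3), ContDiffAt ℝ ∞ (v k) x := fun k x hx =>
    contDiffAt_conjCoord_of_monogenic hB hH hHK hHD k hx
  have hWf : ∀ k (x : unitBall), W k x = conjCoord k ((g + conjMap unitBall h) x) := by
    intro k x
    rw [Pi.add_apply, map_add, hgF]
    change _ = _ + conjCoord k (star (h x))
    rw [hhH]
    fin_cases k <;> simp [hW, hu, hv, hs, conjCoord_zero, conjCoord_one, conjCoord_two]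
  have hWhom : ∀ k, ∀ t : ℝ, 0 < t → ∀ x, ‖x‖ < 1 → ‖t • x‖ < 1 →
      W k (t • x) = t ^ n * W k x := by
    intro k t ht x hx htx
    have h1 := hhom t ht ⟨x, hmem hx⟩ ⟨t • x, hmem htx⟩ rfl
    have h2 := hWf k ⟨t • x, hmem htx⟩
    rw [h1, map_smul, ← hWf] at h2
    exact h2
  have hWs : ∀ k, ∀ x, ‖x‖ < 1 → ContDiffAt ℝ ∞ (W k) x := fun k x hx =>
    (hus k x (hmem hx)).add ((hvs k x (hmem hx)).const_smul (s k))
  have hWl : ∀ k, ∀ x, ‖x‖ < 1 → ∑ i, pd i (pd i (W k)) x = 0 := fun k x hx => by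
    have hnear := hB.mem_nhds (hmem hx)
    rw [sum_pd_pd_add_smul (Filter.eventually_of_mem hnear (hus k))
      (Filter.eventually_of_mem hnear (hvs k)),
      sum_pd_pd_conjCoord_of_monogenic hB hF hFK hFD k (hmem hx),
      sum_pd_pd_conjCoord_of_monogenic hB hH hHK hHD k (hmem hx), mul_zero, add_zero]
  have hcurl : ∀ x ∈ (unitBall : Set R3), pd 1 (W 2) x = pd 2 (W 1) x := fun x hx => by
    have hd : ∀ {w : R3 → ℝ}, ContDiffAt ℝ ∞ w x → DifferentiableAt ℝ w x := fun h =>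
      h.differentiableAt (by simp)
    simp only [hW]
    rw [pd_add (hd (hus 2 x hx)) ((hd (hvs 2 x hx)).const_smul _), pd_const_smul (hd (hvs 2 x hx)),
      pd_add (hd (hus 1 x hx)) ((hd (hvs 1 x hx)).const_smul _), pd_const_smul (hd (hvs 1 x hx)),
      (curl_and_div_eq_zero_of_monogenic hB hF hFK hFD hx).1 1 2,
      (curl_and_div_eq_zero_of_monogenic hB hH hHK hHD hx).1 1 2]
    rfl
  refine ⟨fun k => extendHom n (W k), fun k => extendHom_mem_harmonicHom (hWhom k) (hWs k) (hWl k),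
    ?_, fun x => ?_⟩
  · funext x
    have ht : 0 < (1 + ‖x‖)⁻¹ := by positivity
    have hx := inv_smul_mem_unitBall x
    have h1 := hcurl _ hx
    rw [← pd_congr (extendHom_eventuallyEq (hWhom 2) (mem_unitBall.1 hx)) 1,
      ← pd_congr (extendHom_eventuallyEq (hWhom 1) (mem_unitBall.1 hx)) 2,
      pd_extendHom_smul (hWhom 2) (hWs 2) ht, pd_extendHom_smul (hWhom 1) (hWs 1) ht] at h1
    exact mul_left_cancel₀ (by positivity) h1
  · have hx := mem_unitBall.1 x.2
    beta_reduce
    rw [extendHom_eq_self (hWhom 0) hx, extendHom_eq_self (hWhom 1) hx,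
      extendHom_eq_self (hWhom 2) hx, hWf, hWf, hWf]
    have hK : ((g + conjMap unitBall h) x).imK = 0 := by
      rw [Pi.add_apply, hgF]
      change (F x + star (h x)).imK = 0
      rw [hhH]
      simp [hFK x x.2, hHK x x.2]
    ext
    · rfl
    · exact (neg_neg _).symm
    · exact (neg_neg _).symm
    · exact hK

theorem span_family {n : ℕ} (hn : 0 < n) :
    Submodule.span ℝ (Set.range (family n)) = homogeneousAmbigenic n := by
  refine le_antisymm (Submodule.span_le.2 ?_) fun f hf => ?_
  · rintro _ ⟨i, rfl⟩
    exact family_mem_homogeneousAmbigenic n i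
  -- Positive degree lets `exists_planar_potential` differentiate the components once. The scalar
  -- part and the planar part receive separate potentials w and v.
  · obtain ⟨k, rfl⟩ := Nat.exists_eq_succ_of_ne_zero hn.ne'
    obtain ⟨E, hE, hcurl, hfE⟩ := exists_harmonicHom_of_mem_homogeneousAmbigenic hf
    obtain ⟨v, hv, hv1, hv2⟩ := exists_planar_potential (hE 1) (hE 2) hcurl
    obtain ⟨w, hw, hw0⟩ := exists_pd_zero_eq (harmonicHom_le_solidSpan _ (hE 0))
    have h : f = gradField 1 0 w + gradField 0 1 v := by
      funext x
      rw [hfE]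
      ext <;> simp [gradField, hw0, hv1, hv2]
    rw [h]
    exact Submodule.add_mem _ (gradField_mem_span hw 1 0) (gradField_mem_span hv 0 1)

end SolidHarmonic

end

theorem mainTheorem8 (n : ℕ) (hn : 0 < n) :
    Fintype.card (Fin (n + 2) ⊕ Fin n ⊕ Fin (n + 1) ⊕ Fin (n + 1)) = 4 * n + 4 ∧
    LinearIndependent ℝ (Ambigenic.family n) ∧
    Submodule.span ℝ (Set.range (Ambigenic.family n)) = Ambigenic.homogeneousAmbigenic n ∧
    (∀ i j, i ≠ j →
      Ambigenic.scalarProduct (Ambigenic.family n i) (Ambigenic.family n j) = 0) := by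
  refine ⟨?_, SolidHarmonic.linearIndependent_family hn, SolidHarmonic.span_family hn,
    fun i j hij => SolidHarmonic.scalarProduct_family hij⟩
  simp only [Fintype.card_sum, Fintype.card_fin]
  omega
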